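/- Let $p$ be a prime and $k\ge 0$ an integer, and let $\Delta\subset\mathbb R^d$ be a lattice simplex of dimension $d$ (the convex hull of $d+1$ affinely independent points of $\mathbb Z^d$) whose $\delta$-polynomial $$\delta(\Delta,t)=(1-t)^{d+1}\Bigl(1+\sum_{n\ge1}|n\Delta\cap\mathbb Z^d|\,t^n\Bigr)$$ equals $1+t^{k+1}+t^{2(k+1)}+\cdots+t^{(p^2-1)(k+1)}$. Two sets $P,Q\subset\mathbb R^d$ are unimodularly equivalent if $Q=\{vU+w : v\in P\}$ for some $U\in\mathbb Z^{d\times d}$ with $\det U=\pm1$ and some $w\in\mathbb Z^d$. Suppose that $\Delta$ is not a lattice pyramid over a lower-dimensional lattice simplex, i.e. $\Delta$ is not unimodularly equivalent to $\mathrm{Pyr}(Q)=\mathrm{conv}\bigl(Q\times\{0\}\cup\{(0,\ldots,0,1)\}\bigr)$ for any $(d-1)$-dimensional lattice simplex $Q\subset\mathbb R^{d-1}$. For an integer sequence $A=(a_1,\ldots,a_d)$ let $\Delta(A)\subset\mathbb R^d$ be the convex hull of the origin, the unit vectors $e_1,\ldots,e_{d-1}$ and $(a_d-a_1,\ldots,a_d-a_{d-1},a_d)$.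 For integer sequences $B=(b_1,\ldots,b_s)$ and $C=(c_1,\ldots,c_d)$ with $1\le s<d$ let $\Delta(B,C)\subset\mathbb R^d$ be the convex hull of the origin, the unit vectors $e_i$ with $1\le i\le d-1$, $i\ne s$, and the two vectors $(b_s-b_1,\ldots,b_s-b_{s-1},b_s,0,\ldots,0)$ and $(c_d-c_1,\ldots,c_d-c_{d-1},c_d)$. Then $\Delta$ is unimodularly equivalent to one of $\Delta(A_1)$, $\Delta(A_2)$ and $\Delta(B,C)$ (in particular, $d$ is the length of $A_1$, $A_2$ or $C$, respectively), where 1. $A_1=(\underbrace{1,\ldots,1}_{p^2(k+1)-2},\,p^2)$; 2. $A_2=(\underbrace{1,\ldots,1}_{p(k+1)-1},\,\underbrace{p,\ldots,p}_{(p^2-1)(k+1)-1},\,p^2)$; 3. $B=(\underbrace{1,\ldots,1}_{p(k+1)-1},\,p)$ and $C=(\underbrace{p,\ldots,p}_{p(k+1)},\,\underbrace{1,\ldots,1}_{p^2(k+1)-2},\,p)$. -/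

import Mathlib

open scoped Matrix Pointwise

noncomputable section

namespace LatticeSimplices

/-- The point of `ℝ^d` with the given integer coordinates. -/
def toReal {d : ℕ} (v : Fin d → ℤ) : Fin d → ℝ := fun i => (v i : ℝ)

/-- `P ⊆ ℝ^d` is a lattice simplex of (full) dimension `d`: the convex hull of `d + 1` affinely
independent points with integer coordinates. -/
def IsLatticeSimplex {d : ℕ} (P : Set (Fin d → ℝ)) : Prop :=
  ∃ v : Fin (d + 1) → Fin d → ℤ,
    AffineIndependent ℝ (fun i => toReal (v i)) ∧
    P = convexHull ℝ (Set.range fun i => toReal (v i))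

/-- The number `|nP ∩ ℤ^d|` of lattice points in the `n`-th dilate of `P`. -/
def latticeCount {d : ℕ} (P : Set (Fin d → ℝ)) (n : ℕ) : ℕ :=
  Set.ncard (((n : ℝ) • P) ∩ Set.range (toReal (d := d)))

/-- The `δ`-polynomial of a `d`-dimensional lattice polytope `P ⊆ ℝ^d`, as the formal power series
`δ(P, t) = (1 - t)^(d + 1) * (1 + ∑_{n ≥ 1} |nP ∩ ℤ^d| t^n)`. -/
def deltaSeries {d : ℕ} (P : Set (Fin d → ℝ)) : PowerSeries ℤ :=
  (1 - PowerSeries.X) ^ (d + 1) *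
    PowerSeries.mk (fun n => if n = 0 then 1 else (latticeCount P n : ℤ))

/-- `P` and `Q` are unimodularly equivalent: `Q` is the image of `P` under `v ↦ vU + w` with
`U` an integer matrix of determinant `±1` and `w` an integer vector. -/
def UnimodularlyEquivalent {d : ℕ} (P Q : Set (Fin d → ℝ)) : Prop :=
  ∃ (U : Matrix (Fin d) (Fin d) ℤ) (w : Fin d → ℤ),
    (U.det = 1 ∨ U.det = -1) ∧
    Q = (fun v : Fin d → ℝ => v ᵥ* U.map (fun z : ℤ => (z : ℝ)) + toReal w) '' P

/-- `Pyr(P) = conv(P × {0}, (0, …, 0, 1)) ⊆ ℝ^(d + 1)`. -/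
def pyramid {d : ℕ} (P : Set (Fin d → ℝ)) : Set (Fin (d + 1) → ℝ) :=
  convexHull ℝ
    (insert (Fin.snoc (α := fun _ => ℝ) (0 : Fin d → ℝ) 1)
      ((fun x : Fin d → ℝ => Fin.snoc (α := fun _ => ℝ) x 0) '' P))

/-- `P ⊆ ℝ^d` is, up to unimodular equivalence, the lattice pyramid over a lattice simplex of
dimension `d - 1`. (A subset of `ℝ^0` is never a pyramid.) -/
def IsLatticePyramid : {d : ℕ} → Set (Fin d → ℝ) → Prop
  | 0, _ => False
  | d + 1, P => ∃ Q : Set (Fin d → ℝ), IsLatticeSimplex Q ∧ UnimodularlyEquivalent P (pyramid Q)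

/-- The convex hull of the origin and the rows of an integer matrix. -/
def rowSimplex {d : ℕ} (M : Matrix (Fin d) (Fin d) ℤ) : Set (Fin d → ℝ) :=
  convexHull ℝ (insert 0 (Set.range fun i => toReal (M i)))

/-- The matrix with rows `e_1, …, e_{d-1}` and `(a_d - a_1, …, a_d - a_{d-1}, a_d)`.
Indices of `Fin d` start from `0`, so the last row is the one with `i + 1 = d`. -/
def matrixA {d : ℕ} (A : Fin d → ℤ) : Matrix (Fin d) (Fin d) ℤ :=
  Matrix.of fun i j =>
    if (i : ℕ) + 1 = d then (if j = i then A i else A i - A j)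
    else if j = i then 1 else 0

/-- The simplex `Δ(A)`. -/
def simplexA {d : ℕ} (A : Fin d → ℤ) : Set (Fin d → ℝ) :=
  rowSimplex (matrixA A)

/-- The matrix whose `s`-th row is `(b_s - b_1, …, b_s - b_{s-1}, b_s, 0, …, 0)`, whose `d`-th row
is `(c_d - c_1, …, c_d - c_{d-1}, c_d)`, and whose other rows are unit vectors
(meant for `1 ≤ s < d`). -/
def matrixBC {s d : ℕ} (B : Fin s → ℤ) (C : Fin d → ℤ) : Matrix (Fin d) (Fin d) ℤ :=
  Matrix.of fun i j =>
    if (i : ℕ) + 1 = d then (if j = i then C i else C i - C j)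
    else if hi : (i : ℕ) + 1 = s then
      (if j = i then B ⟨i, by omega⟩
       else if hj : (j : ℕ) < s then B ⟨i, by omega⟩ - B ⟨j, hj⟩
       else 0)
    else if j = i then 1 else 0

/-- The simplex `Δ(B, C)`. -/
def simplexBC {s d : ℕ} (B : Fin s → ℤ) (C : Fin d → ℤ) : Set (Fin d → ℝ) :=
  rowSimplex (matrixBC B C)

/-- The sequence `(1, …, 1, p²)` with `p²(k+1) - 2` ones. -/
def listA₁ (p k : ℕ) : List ℤ :=
  List.replicate (p ^ 2 * (k + 1) - 2) 1 ++ [(p : ℤ) ^ 2]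

/-- The sequence `(1, …, 1, p, …, p, p²)` with `p(k+1) - 1` ones and
`(p² - 1)(k+1) - 1` entries `p`. -/
def listA₂ (p k : ℕ) : List ℤ :=
  List.replicate (p * (k + 1) - 1) 1 ++
    List.replicate ((p ^ 2 - 1) * (k + 1) - 1) (p : ℤ) ++ [(p : ℤ) ^ 2]

/-- The sequence `(1, …, 1, p)` with `p(k+1) - 1` ones. -/
def listB (p k : ℕ) : List ℤ :=
  List.replicate (p * (k + 1) - 1) 1 ++ [(p : ℤ)]

/-- The sequence `(p, …, p, 1, …, 1, p)` with `p(k+1)` initial entries `p` and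
`p²(k+1) - 2` ones. -/
def listC (p k : ℕ) : List ℤ :=
  List.replicate (p * (k + 1)) (p : ℤ) ++
    List.replicate (p ^ 2 * (k + 1) - 2) 1 ++ [(p : ℤ)]

end LatticeSimplices

end

/-!
Attach to a lattice simplex with vertices `v₀, …, v_d` the finite group of barycentric relations
modulo `1`, i.e. of all `θ ∈ (ℝ/ℤ)^(d+1)` with `∑ θᵢ = 0` and `∑ θᵢ vᵢ = 0`. It determines the
simplex up to unimodular equivalence, its elements counted by height (the sum of the
representatives in `[0, 1)`) give the coefficients of the `δ`-polynomial, and the simplex is a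
pyramid with apex `vᵢ` when the `i`-th coordinate vanishes on the group.

Under the hypothesis on the `δ`-polynomial, `h = height / (k + 1)` is a subadditive bijection from
the group onto `{0, …, p² - 1}`. If `h x = 1`, then subadditivity and injectivity give `h (a x) = a`
for all `a` below the order of `x`, which is `p` or `p²`; in the first case also
`h (i y + j x) = i p + j` for `h y = p` and `i, j < p`. As no carries occur in these sums, the
coordinates of the generators are so small that they can only be `0`, `1/p` or `1/p²`, and the
heights count how often each value occurs. Up to the order of the vertices three groups remain, and
they are the groups of the simplices `Δ(A₁)`, `Δ(A₂)` and `Δ(B, C)`.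
-/

noncomputable section

namespace LatticeSimplices

section SubadditiveBijection

variable {Q : Type*} [AddCommGroup Q] {h : Q → ℕ}

theorem apply_nsmul_le (h0 : h 0 = 0) (hadd : ∀ a b, h (a + b) ≤ h a + h b) (x : Q) (a : ℕ) :
    h (a • x) ≤ a * h x := by
  induction a with
  | zero => simp [h0]
  | succ a ih =>
    rw [succ_nsmul, add_mul, one_mul]
    exact (hadd _ _).trans (Nat.add_le_add_right ih _)

theorem eq_self_of_injOn_of_le {n : ℕ} {g : ℕ → ℕ} (hinj : Set.InjOn g (Set.Iio n))
    (hle : ∀ a < n, g a ≤ a) : ∀ a < n, g a = a := by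
  intro a
  induction a using Nat.strong_induction_on with
  | _ a ih =>
    intro ha
    rcases (hle a ha).lt_or_eq with hlt | heq
    · exact hinj (hlt.trans ha) ha (ih _ hlt (hlt.trans ha))
    · exact heq

theorem apply_nsmul_eq_of_lt_addOrderOf (h0 : h 0 = 0) (hadd : ∀ a b, h (a + b) ≤ h a + h b)
    (hinj : Function.Injective h) {x : Q} (hx : h x = 1) :
    ∀ a < addOrderOf x, h (a • x) = a :=
  eq_self_of_injOn_of_le (g := fun a => h (a • x))
    (fun _ ha _ hb hab => nsmul_injOn_Iio_addOrderOf ha hb (hinj hab))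
    fun a _ => by simpa [hx] using apply_nsmul_le h0 hadd x a

theorem addOrderOf_quotient_zmultiples {p : ℕ} (hp : p.Prime) {x y : Q}
    (hindex : (AddSubgroup.zmultiples x).index = p) (hy : y ∉ AddSubgroup.zmultiples x) :
    addOrderOf (y : Q ⧸ AddSubgroup.zmultiples x) = p := by
  have : Fact p.Prime := ⟨hp⟩
  refine addOrderOf_eq_prime ?_ ((QuotientAddGroup.eq_zero_iff y).not.2 hy)
  rw [← hindex]
  exact card_nsmul_eq_zero'

theorem apply_div_nsmul_add_mod_nsmul {p : ℕ} (hp : 0 < p) (h0 : h 0 = 0)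
    (hadd : ∀ a b, h (a + b) ≤ h a + h b) (hinj : Function.Injective h) {x y : Q}
    (hx : h x = 1) (hy : h y = p) (hordx : addOrderOf x = p)
    (hordy : addOrderOf (y : Q ⧸ AddSubgroup.zmultiples x) = p) :
    ∀ a < p ^ 2, h ((a / p) • y + (a % p) • x) = a := by
  have hquot (a b : ℕ) : ((a • y + b • x : Q) : Q ⧸ AddSubgroup.zmultiples x) = a • (y : _) := by
    have hx0 : (x : Q ⧸ AddSubgroup.zmultiples x) = 0 :=
      (QuotientAddGroup.eq_zero_iff x).2 (AddSubgroup.mem_zmultiples x)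
    simp only [QuotientAddGroup.mk_add, QuotientAddGroup.mk_nsmul, hx0, smul_zero, add_zero]
  have hdiv {a : ℕ} (ha : a < p ^ 2) : a / p < addOrderOf (y : Q ⧸ AddSubgroup.zmultiples x) := by
    rw [hordy]
    exact Nat.div_lt_of_lt_mul (by rwa [← sq])
  have hmod (a : ℕ) : a % p < addOrderOf x := hordx.symm ▸ Nat.mod_lt a hp
  refine eq_self_of_injOn_of_le (g := fun a => h ((a / p) • y + (a % p) • x)) ?_ fun a _ => ?_
  · intro a ha b hb hab
    have hab := hinj hab
    have hdiv_eq : a / p = b / p := by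
      refine nsmul_injOn_Iio_addOrderOf (hdiv ha) (hdiv hb) ?_
      simpa only [hquot] using congrArg (QuotientAddGroup.mk (s := AddSubgroup.zmultiples x)) hab
    rw [hdiv_eq] at hab
    have hmod_eq : a % p = b % p :=
      nsmul_injOn_Iio_addOrderOf (hmod a) (hmod b) (add_left_cancel hab)
    rw [← Nat.div_add_mod a p, ← Nat.div_add_mod b p, hdiv_eq, hmod_eq]
  · calc h ((a / p) • y + (a % p) • x) ≤ a / p * h y + a % p * h x :=
          (hadd _ _).trans (add_le_add (apply_nsmul_le h0 hadd _ _) (apply_nsmul_le h0 hadd _ _))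
      _ = a := by rw [hx, hy, mul_one, Nat.div_add_mod']

theorem apply_nsmul_add_nsmul {p : ℕ} (hp : 0 < p) (h0 : h 0 = 0)
    (hadd : ∀ a b, h (a + b) ≤ h a + h b) (hinj : Function.Injective h) {x y : Q}
    (hx : h x = 1) (hy : h y = p) (hordx : addOrderOf x = p)
    (hordy : addOrderOf (y : Q ⧸ AddSubgroup.zmultiples x) = p) :
    ∀ i < p, ∀ j < p, h (i • y + j • x) = i * p + j := by
  intro i hi j hj
  have hdiv : (i * p + j) / p = i := by
    rw [add_comm, Nat.add_mul_div_right _ _ hp, Nat.div_eq_of_lt hj, zero_add]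
  have hmod : (i * p + j) % p = j := by
    rw [add_comm, Nat.add_mul_mod_self_right, Nat.mod_eq_of_lt hj]
  simpa only [hdiv, hmod] using
    apply_div_nsmul_add_mod_nsmul hp h0 hadd hinj hx hy hordx hordy (i * p + j) (by nlinarith)

theorem exists_nsmul_eq_of_mem_zmultiples {n : ℕ} (hn : 0 < n) {x q : Q}
    (hord : addOrderOf x = n) (hq : q ∈ AddSubgroup.zmultiples x) : ∃ j < n, j • x = q := by
  classical
  subst hord
  rw [(addOrderOf_pos_iff.1 hn).mem_zmultiples_iff_mem_range_addOrderOf] at hq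
  simpa using hq

theorem card_eq_of_bijOn {α : Type*} {f : α → ℕ} {n : ℕ}
    (hf : Set.BijOn f Set.univ (Set.Iio n)) : Nat.card α = n := by
  rw [← Nat.card_univ, Nat.card_congr hf.equiv]
  simp

theorem exists_generators_of_addOrderOf_eq {p : ℕ} (hp : p.Prime) (h0 : h 0 = 0)
    (hadd : ∀ a b, h (a + b) ≤ h a + h b) (hbij : Set.BijOn h Set.univ (Set.Iio (p ^ 2)))
    {x : Q} (hx : h x = 1) (hord : addOrderOf x = p) :
    ∃ y : Q, (∃ j < p, j • x = p • y) ∧ (∀ i < p, ∀ j < p, h (i • y + j • x) = i * p + j) ∧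
      AddSubgroup.closure {x, y} = ⊤ := by
  have hinj : Function.Injective h := Set.injOn_univ.1 hbij.injOn
  have hindex : (AddSubgroup.zmultiples x).index = p := by
    have := (AddSubgroup.zmultiples x).index_mul_card
    rw [Nat.card_zmultiples, hord, card_eq_of_bijOn hbij, sq] at this
    exact Nat.eq_of_mul_eq_mul_right hp.pos this
  obtain ⟨y, -, hy⟩ := hbij.surjOn (show p ∈ Set.Iio (p ^ 2) from lt_self_pow₀ hp.one_lt one_lt_two)
  have hyx : y ∉ AddSubgroup.zmultiples x := by
    intro hyx
    obtain ⟨j, hj, rfl⟩ := exists_nsmul_eq_of_mem_zmultiples hp.pos hord hyx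
    exact hj.ne ((apply_nsmul_eq_of_lt_addOrderOf h0 hadd hinj hx j (hord ▸ hj)).symm.trans hy)
  have hxy := apply_nsmul_add_nsmul hp.pos h0 hadd hinj hx hy hord
    (addOrderOf_quotient_zmultiples hp hindex hyx)
  refine ⟨y, exists_nsmul_eq_of_mem_zmultiples hp.pos hord
    (hindex ▸ AddSubgroup.nsmul_index_mem _ y), hxy, eq_top_iff.2 fun q _ => ?_⟩
  have hq : (h q / p) • y + (h q % p) • x = q := by
    refine hinj ((hxy _ ?_ _ (Nat.mod_lt _ hp.pos)).trans (Nat.div_add_mod' _ _))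
    exact Nat.div_lt_of_lt_mul (by simpa [← sq] using hbij.mapsTo (Set.mem_univ q))
  rw [← hq]
  exact add_mem (nsmul_mem (AddSubgroup.subset_closure (by simp)) _)
    (nsmul_mem (AddSubgroup.subset_closure (by simp)) _)

theorem exists_generators_of_subadditive_bijOn {p : ℕ} (hp : p.Prime) (h0 : h 0 = 0)
    (hadd : ∀ a b, h (a + b) ≤ h a + h b) (hbij : Set.BijOn h Set.univ (Set.Iio (p ^ 2))) :
    (∃ x : Q, p ^ 2 • x = 0 ∧ (∀ a < p ^ 2, h (a • x) = a) ∧ AddSubgroup.zmultiples x = ⊤) ∨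
    ∃ x y : Q, p • x = 0 ∧ (∃ j < p, j • x = p • y) ∧
      (∀ i < p, ∀ j < p, h (i • y + j • x) = i * p + j) ∧ AddSubgroup.closure {x, y} = ⊤ := by
  have hinj : Function.Injective h := Set.injOn_univ.1 hbij.injOn
  obtain ⟨x, -, hx⟩ := hbij.surjOn
    (show 1 ∈ Set.Iio (p ^ 2) from one_lt_pow₀ hp.one_lt two_ne_zero)
  have hxa := apply_nsmul_eq_of_lt_addOrderOf h0 hadd hinj hx
  obtain ⟨i, hi, hord⟩ :=
    (Nat.dvd_prime_pow hp).1 (card_eq_of_bijOn hbij ▸ addOrderOf_dvd_natCard x)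
  interval_cases i
  · rw [pow_zero, AddMonoid.addOrderOf_eq_one_iff] at hord
    simp [hord, h0] at hx
  · rw [pow_one] at hord
    exact .inr ⟨x, (exists_generators_of_addOrderOf_eq hp h0 hadd hbij hx hord).imp fun y hy =>
      ⟨hord ▸ addOrderOf_nsmul_eq_zero x, hy⟩⟩
  · rw [hord] at hxa
    refine .inl ⟨x, hord ▸ addOrderOf_nsmul_eq_zero x, hxa, eq_top_iff.2 fun q _ => ?_⟩
    rw [← hinj (hxa (h q) (hbij.mapsTo (Set.mem_univ q)))]
    exact nsmul_mem (AddSubgroup.mem_zmultiples x) _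

end SubadditiveBijection

section Torus

/-- The representative in `[0, 1)` of a class modulo `1`. -/
def fracPart (x : UnitAddCircle) : ℝ := AddCircle.equivIco 1 0 x

@[simp]
theorem fracPart_coe (x : ℝ) : fracPart (x : UnitAddCircle) = Int.fract x := by
  simp [fracPart, AddCircle.coe_equivIco_mk_apply]

@[simp]
theorem coe_fracPart (x : UnitAddCircle) : (fracPart x : UnitAddCircle) = x :=
  AddCircle.coe_equivIco

theorem fracPart_nonneg (x : UnitAddCircle) : 0 ≤ fracPart x :=
  (AddCircle.equivIco 1 0 x).2.1

theorem fracPart_lt_one (x : UnitAddCircle) : fracPart x < 1 :=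
  (AddCircle.equivIco 1 0 x).2.2.trans_eq (zero_add 1)

@[simp]
theorem fracPart_zero : fracPart 0 = 0 := by
  rw [← AddCircle.coe_zero, fracPart_coe, Int.fract_zero]

theorem fracPart_add_le (x y : UnitAddCircle) : fracPart (x + y) ≤ fracPart x + fracPart y := by
  induction x using QuotientAddGroup.induction_on
  induction y using QuotientAddGroup.induction_on
  rw [← AddCircle.coe_add, fracPart_coe, fracPart_coe, fracPart_coe]
  exact Int.fract_add_le _ _

/-- The class of `1 / q` modulo `1`, which is `0` for `q = 0`. -/
def unitFrac (q : ℕ) : UnitAddCircle := ((1 / q : ℝ) : UnitAddCircle)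

@[simp]
theorem nsmul_unitFrac_self (q : ℕ) : q • unitFrac q = 0 := by
  rcases eq_or_ne q 0 with rfl | hq
  · exact zero_nsmul _
  · rw [unitFrac, ← AddCircle.coe_nsmul, nsmul_eq_mul, mul_one_div_cancel (Nat.cast_ne_zero.2 hq),
      AddCircle.coe_period]

@[simp]
theorem nsmul_unitFrac_sq (p : ℕ) : p • unitFrac (p ^ 2) = unitFrac p := by
  rw [unitFrac, unitFrac, ← AddCircle.coe_nsmul, nsmul_eq_mul]
  congr 1
  rcases eq_or_ne p 0 with rfl | hp
  · simp
  · field_simp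
    push_cast
    ring

theorem fracPart_nsmul_unitFrac {a q : ℕ} (ha : a < q) :
    fracPart (a • unitFrac q) = a / q := by
  have hq : (0 : ℝ) < q := by exact_mod_cast (Nat.zero_le a).trans_lt ha
  rw [unitFrac, ← AddCircle.coe_nsmul, nsmul_eq_mul, mul_one_div, fracPart_coe, Int.fract_eq_self]
  exact ⟨by positivity, (div_lt_one hq).2 (by exact_mod_cast ha)⟩

theorem exists_eq_nsmul_unitFrac {q : ℕ} (hq : 0 < q) {x : UnitAddCircle} (hx : q • x = 0) :
    ∃ a < q, x = a • unitFrac q := by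
  obtain ⟨a, ha, rfl⟩ := (AddCircle.nsmul_eq_zero_iff hq).1 hx
  refine ⟨a, ha, ?_⟩
  rw [unitFrac, ← AddCircle.coe_nsmul, nsmul_eq_mul, mul_one_div, mul_one]

theorem eq_zero_or_eq_unitFrac {q : ℕ} (hq : 0 < q) {x : UnitAddCircle} (hx : q • x = 0)
    (hlt : (q - 1) * fracPart x < 1) : x = 0 ∨ x = unitFrac q := by
  obtain ⟨a, ha, rfl⟩ := exists_eq_nsmul_unitFrac hq hx
  have ha2 : a < 2 := by
    by_contra! h2
    have hq' : (2 : ℝ) < q + 1 := by exact_mod_cast (by omega : 2 < q + 1)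
    rw [fracPart_nsmul_unitFrac ha, ← mul_div_assoc, div_lt_one (by positivity)] at hlt
    have : (2 : ℝ) ≤ a := by exact_mod_cast h2
    have : (a : ℝ) + 1 ≤ q := by exact_mod_cast ha
    nlinarith
  interval_cases a
  · exact .inl (zero_nsmul _)
  · exact .inr (one_nsmul _)

theorem fracPart_unitFrac {q : ℕ} (hq : 1 < q) : fracPart (unitFrac q) = 1 / q := by
  simpa using fracPart_nsmul_unitFrac hq

variable {ι : Type*} [Fintype ι]

/-- The sum of the coordinates of the representative in `[0, 1)^ι` of a point of `(ℝ/ℤ)^ι`. -/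
def height (θ : ι → UnitAddCircle) : ℝ := ∑ i, fracPart (θ i)

@[simp]
theorem height_zero : height (0 : ι → UnitAddCircle) = 0 := by simp [height]

theorem height_nonneg (θ : ι → UnitAddCircle) : 0 ≤ height θ :=
  Finset.sum_nonneg fun i _ => fracPart_nonneg (θ i)

theorem height_add_le (θ η : ι → UnitAddCircle) : height (θ + η) ≤ height θ + height η := by
  rw [height, height, height, ← Finset.sum_add_distrib]
  exact Finset.sum_le_sum fun i _ => fracPart_add_le (θ i) (η i)

theorem height_lt_card [Nonempty ι] (θ : ι → UnitAddCircle) : height θ < Fintype.card ι := by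
  simpa [height] using
    Finset.sum_lt_sum_of_nonempty Finset.univ_nonempty fun i _ => fracPart_lt_one (θ i)

theorem lt_one_of_height_eq_sum {t : ι → ℝ} (ht : ∀ i, 0 ≤ t i)
    (hsum : height (fun i => (t i : UnitAddCircle)) = ∑ i, t i) (i : ι) : t i < 1 := by
  have hle (i : ι) : Int.fract (t i) ≤ t i := by
    have : (0 : ℝ) ≤ ⌊t i⌋ := by exact_mod_cast Int.floor_nonneg.2 (ht i)
    linarith [Int.floor_add_fract (t i)]
  simp only [height, fracPart_coe] at hsum
  rw [← (Finset.sum_eq_sum_iff_of_le fun i _ => hle i).1 hsum i (Finset.mem_univ i)]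
  exact Int.fract_lt_one _

end Torus

section RelationGroup

variable {ι κ κ' : Type*} [Fintype ι]

/-- The group of relations modulo `1` between the rows of an integer matrix `M`: the points `θ` of
`(ℝ/ℤ)^ι` with `θ M = 0`. -/
def relationGroup (M : Matrix ι κ ℤ) : AddSubgroup (ι → UnitAddCircle) where
  carrier := {θ | ∀ k, ∑ i, M i k • θ i = 0}
  zero_mem' := by simp
  add_mem' hθ hη k := by simp [Finset.sum_add_distrib, hθ k, hη k]
  neg_mem' hθ k := by simp [hθ k]

theorem mem_relationGroup {M : Matrix ι κ ℤ} {θ : ι → UnitAddCircle} :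
    θ ∈ relationGroup M ↔ ∀ k, ∑ i, M i k • θ i = 0 :=
  Iff.rfl

theorem coe_mem_relationGroup {M : Matrix ι κ ℤ} {t : ι → ℝ} :
    (fun i => (t i : UnitAddCircle)) ∈ relationGroup M ↔
      ∃ z : κ → ℤ, t ᵥ* M.map (↑) = fun k => (z k : ℝ) := by
  have hsum (k : κ) : ∑ i, M i k • (t i : UnitAddCircle) =
      ((t ᵥ* M.map (↑) : κ → ℝ) k : UnitAddCircle) := by
    have := map_sum (QuotientAddGroup.mk' (AddSubgroup.zmultiples (1 : ℝ)))
      (fun i => M i k • t i) Finset.univ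
    rw [Matrix.vecMul, dotProduct]
    simp only [Matrix.map_apply, ← zsmul_eq_mul']
    exact this.symm
  simp only [mem_relationGroup, hsum, AddCircle.coe_eq_zero_iff, zsmul_one, Classical.skolem,
    funext_iff, eq_comm (a := (t ᵥ* M.map (↑) : κ → ℝ) _)]

variable [DecidableEq ι]

theorem det_smul_eq_zero_of_mem_relationGroup {M : Matrix ι ι ℤ} {θ : ι → UnitAddCircle}
    (hθ : θ ∈ relationGroup M) (j : ι) : M.det • θ j = 0 :=
  calc M.det • θ j = ∑ i, (M * M.adjugate) i j • θ i := by
        simp [Matrix.mul_adjugate, Matrix.one_apply]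
    _ = ∑ k, M.adjugate k j • ∑ i, M i k • θ i := by
        simp only [Matrix.mul_apply, Finset.sum_smul, Finset.smul_sum, smul_smul, mul_comm]
        exact Finset.sum_comm
    _ = 0 := by simp [mem_relationGroup.1 hθ]

theorem finite_relationGroup {M : Matrix ι ι ℤ} (hM : M.det ≠ 0) :
    (relationGroup M : Set (ι → UnitAddCircle)).Finite :=
  (Set.Finite.pi' fun _ => AddCircle.finite_torsion_of_isSMulRegular_int 1 M.det
    (.of_right_eq_zero_of_smul fun x hx => by simpa [hM] using hx)).subset
      fun _ hθ j => det_smul_eq_zero_of_mem_relationGroup hθ j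

/-- A row vector whose product with `M` is integral has an integral product with `N`; applied to
the rows of `M⁻¹` this shows that `M⁻¹ N` is integral. -/
theorem exists_eq_mul_of_relationGroup_le {M : Matrix ι ι ℤ} (hM : M.det ≠ 0) {N : Matrix ι κ ℤ}
    (hMN : relationGroup M ≤ relationGroup N) : ∃ W : Matrix ι κ ℤ, N = M * W := by
  set R : Matrix ι ι ℝ := M.map (↑) with hR
  have hdet : IsUnit R.det := by
    rw [hR, ← Int.cast_det]
    exact isUnit_iff_ne_zero.2 (Int.cast_ne_zero.2 hM)
  have hrow (i : ι) : ∃ z : κ → ℤ, R⁻¹ i ᵥ* N.map (↑) = fun k => (z k : ℝ) := by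
    refine coe_mem_relationGroup.1 (hMN (coe_mem_relationGroup.2 ⟨Pi.single i 1, ?_⟩))
    rw [← Matrix.mul_apply_eq_vecMul, Matrix.nonsing_inv_mul _ hdet]
    ext j
    simp [Matrix.one_apply, Pi.single_apply, eq_comm]
  choose W hW using hrow
  have hinv : R⁻¹ * N.map (fun z => (z : ℝ)) = (Matrix.of W).map (↑) :=
    Matrix.ext fun i k => congrFun (hW i) k
  refine ⟨Matrix.of W, Matrix.map_injective (f := fun z : ℤ => (z : ℝ)) Int.cast_injective ?_⟩
  calc N.map (fun z : ℤ => (z : ℝ)) = R * (R⁻¹ * N.map fun z : ℤ => (z : ℝ)) :=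
        (Matrix.mul_nonsing_inv_cancel_left _ _ hdet).symm
    _ = R * (Matrix.of W).map fun z : ℤ => (z : ℝ) := by rw [hinv]
    _ = (M * Matrix.of W).map fun z : ℤ => (z : ℝ) :=
        (Matrix.map_mul (f := Int.castRingHom ℝ)).symm

end RelationGroup

section SimplexGroup

variable {d : ℕ}

/-- The integer matrix with rows `(1, v i)`. -/
def homogenization {ι : Type*} (v : ι → Fin d → ℤ) : Matrix ι (Fin (d + 1)) ℤ :=
  Matrix.of fun i => Fin.cons 1 (v i)

/-- The group attached to the simplex with vertices `v`: the barycentric relations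
modulo `1` between its vertices. -/
def simplexGroup {ι : Type*} [Fintype ι] (v : ι → Fin d → ℤ) : AddSubgroup (ι → UnitAddCircle) :=
  relationGroup (homogenization v)

theorem mem_simplexGroup {ι : Type*} [Fintype ι] {v : ι → Fin d → ℤ} {θ : ι → UnitAddCircle} :
    θ ∈ simplexGroup v ↔ ∑ i, θ i = 0 ∧ ∀ j, ∑ i, v i j • θ i = 0 := by
  simp [simplexGroup, mem_relationGroup, homogenization, Fin.forall_fin_succ]

theorem vecMul_homogenization {ι : Type*} [Fintype ι] (v : ι → Fin d → ℤ) (t : ι → ℝ) :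
    t ᵥ* (homogenization v).map (↑) =
      Fin.cons (α := fun _ => ℝ) (∑ i, t i) (∑ i, t i • toReal (v i)) := by
  ext j
  refine Fin.cases ?_ (fun j => ?_) j <;>
    simp [Matrix.vecMul, dotProduct, homogenization, toReal]

theorem coe_mem_simplexGroup {ι : Type*} [Fintype ι] {v : ι → Fin d → ℤ} {t : ι → ℝ} :
    (fun i => (t i : UnitAddCircle)) ∈ simplexGroup v ↔
      (∃ n : ℤ, ∑ i, t i = n) ∧ ∃ x : Fin d → ℤ, ∑ i, t i • toReal (v i) = toReal x := by
  rw [simplexGroup, coe_mem_relationGroup, vecMul_homogenization]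
  constructor
  · rintro ⟨z, hz⟩
    exact ⟨⟨z 0, congrFun hz 0⟩, fun j => z j.succ, funext fun j => congrFun hz j.succ⟩
  · rintro ⟨⟨n, hn⟩, x, hx⟩
    refine ⟨Fin.cons n x, funext fun j => ?_⟩
    refine Fin.cases ?_ (fun j => ?_) j <;> simp [hn, hx, toReal]

theorem affineIndependent_iff_det_homogenization_ne_zero {v : Fin (d + 1) → Fin d → ℤ} :
    AffineIndependent ℝ (fun i => toReal (v i)) ↔ (homogenization v).det ≠ 0 := by
  have hdet : (homogenization v).det ≠ 0 ↔
      LinearIndependent ℝ ((homogenization v).map fun z : ℤ => (z : ℝ)).row := by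
    rw [Matrix.linearIndependent_rows_iff_isUnit, Matrix.isUnit_iff_isUnit_det,
      isUnit_iff_ne_zero, ← Int.cast_det, Int.cast_ne_zero]
  rw [hdet, affineIndependent_iff_of_fintype, Fintype.linearIndependent_iff]
  refine forall_congr' fun t => ?_
  have hsum : ∑ i, t i • ((homogenization v).map fun z : ℤ => (z : ℝ)).row i =
      Fin.cons (α := fun _ => ℝ) (∑ i, t i) (∑ i, t i • toReal (v i)) := by
    rw [← vecMul_homogenization, Matrix.vecMul_eq_sum]
    rfl
  have hzero : (0 : Fin (d + 1) → ℝ) = Fin.cons (α := fun _ => ℝ) 0 0 :=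
    (Matrix.cons_zero_zero (n := d)).symm
  rw [hsum, hzero, Fin.cons_inj, and_imp]
  refine forall_congr' fun h0 => ?_
  rw [Finset.weightedVSub_eq_linear_combination _ h0]

/-- The affine map `y ↦ yU + x`, a unimodular equivalence when `det U = ±1`. -/
def latticeAffineMap (U : Matrix (Fin d) (Fin d) ℤ) (x : Fin d → ℤ) :
    (Fin d → ℝ) →ᵃ[ℝ] (Fin d → ℝ) :=
  (Matrix.vecMulLinear (U.map fun z : ℤ => (z : ℝ))).toAffineMap +
    AffineMap.const ℝ _ (toReal x)

theorem latticeAffineMap_toReal (U : Matrix (Fin d) (Fin d) ℤ) (x y : Fin d → ℤ) :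
    latticeAffineMap U x (toReal y) = toReal (y ᵥ* U + x) := by
  ext j
  simp [latticeAffineMap, toReal, Matrix.vecMul, dotProduct]

theorem latticeAffineMap_injective {U : Matrix (Fin d) (Fin d) ℤ} (hU : IsUnit U.det)
    (x : Fin d → ℤ) : Function.Injective (latticeAffineMap U x) := by
  have hdet : IsUnit (U.map fun z : ℤ => (z : ℝ)) := by
    rw [Matrix.isUnit_iff_isUnit_det, ← Int.cast_det]
    exact hU.map (Int.castRingHom ℝ)
  intro y z hyz
  simpa [latticeAffineMap, (Matrix.vecMul_injective_iff_isUnit.2 hdet).eq_iff] using hyz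

theorem unimodularlyEquivalent_convexHull {ι : Type*} (v : ι → Fin d → ℤ)
    {U : Matrix (Fin d) (Fin d) ℤ} (hU : IsUnit U.det) (x : Fin d → ℤ) :
    UnimodularlyEquivalent (convexHull ℝ (Set.range fun i => toReal (v i)))
      (convexHull ℝ (Set.range fun i => toReal (v i ᵥ* U + x))) := by
  refine ⟨U, x, Int.isUnit_iff.1 hU, ?_⟩
  simp only [← latticeAffineMap_toReal]
  rw [← Function.comp_def (latticeAffineMap U x), Set.range_comp]
  exact ((latticeAffineMap U x).image_convexHull _).symm

theorem unimodularlyEquivalent_of_simplexGroup_eq {v w : Fin (d + 1) → Fin d → ℤ}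
    (hv : AffineIndependent ℝ fun i => toReal (v i))
    (hw : AffineIndependent ℝ fun i => toReal (w i)) (h : simplexGroup v = simplexGroup w) :
    UnimodularlyEquivalent (convexHull ℝ (Set.range fun i => toReal (v i)))
      (convexHull ℝ (Set.range fun i => toReal (w i))) := by
  rw [affineIndependent_iff_det_homogenization_ne_zero] at hv hw
  obtain ⟨W, hW⟩ := exists_eq_mul_of_relationGroup_le hv h.le
  obtain ⟨V, hV⟩ := exists_eq_mul_of_relationGroup_le hw h.ge
  have hWdet : IsUnit W.det := by
    have hWV : (homogenization v).det * (W.det * V.det) = (homogenization v).det * 1 := by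
      rw [← mul_assoc, ← Matrix.det_mul, ← hW, ← Matrix.det_mul, ← hV, mul_one]
    exact .of_mul_eq_one _ (mul_left_cancel₀ hv hWV)
  have hcol : W.col 0 = Pi.single 0 1 := by
    refine sub_eq_zero.1 (Matrix.eq_zero_of_mulVec_eq_zero hv ?_)
    rw [Matrix.mulVec_sub, sub_eq_zero, Matrix.mulVec_single_one]
    ext i
    exact (congrFun₂ hW i 0).symm
  have hW0 (i : Fin (d + 1)) : W i 0 = (Pi.single 0 1 : Fin (d + 1) → ℤ) i := congrFun hcol i
  have hw_eq : w = fun i => v i ᵥ* W.submatrix Fin.succ Fin.succ + fun j => W 0 j.succ := by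
    ext i j
    have := congrFun₂ hW i j.succ
    rw [Matrix.mul_apply, Fin.sum_univ_succ] at this
    simpa [homogenization, Matrix.vecMul, dotProduct, add_comm] using this
  rw [hw_eq]
  refine unimodularlyEquivalent_convexHull v ?_ _
  rw [Matrix.det_succ_column_zero, Fin.sum_univ_succ] at hWdet
  simpa [hW0] using hWdet

end SimplexGroup

section DeltaSeries

theorem convexHull_range_eq_image_stdSimplex {ι E : Type*} [Fintype ι] [AddCommGroup E]
    [Module ℝ E] (f : ι → E) :
    convexHull ℝ (Set.range f) = Fintype.linearCombination ℝ f '' stdSimplex ℝ ι := by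
  classical
  rw [← convexHull_rangle_single_eq_stdSimplex, LinearMap.image_convexHull, ← Set.range_comp]
  congr 2
  ext i
  simp [Fintype.linearCombination_apply_single]

theorem mem_smul_convexHull_range_iff {ι E : Type*} [Fintype ι] [AddCommGroup E] [Module ℝ E]
    (f : ι → E) {r : ℝ} (hr : 0 < r) (x : E) :
    x ∈ r • convexHull ℝ (Set.range f) ↔
      ∃ t : ι → ℝ, (∀ i, 0 ≤ t i) ∧ ∑ i, t i = r ∧ ∑ i, t i • f i = x := by
  rw [convexHull_range_eq_image_stdSimplex, Set.mem_smul_set]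
  constructor
  · rintro ⟨_, ⟨t, ⟨ht, hsum⟩, rfl⟩, rfl⟩
    refine ⟨r • t, fun i => mul_nonneg hr.le (ht i), ?_, ?_⟩
    · simp [← Finset.mul_sum, hsum]
    · simp [Fintype.linearCombination_apply, Finset.smul_sum, mul_smul]
  · rintro ⟨t, ht, hsum, rfl⟩
    refine ⟨_, ⟨r⁻¹ • t, ⟨fun i => mul_nonneg (inv_nonneg.2 hr.le) (ht i), ?_⟩, rfl⟩, ?_⟩
    · simp [← Finset.mul_sum, hsum, hr.ne']
    · rw [map_smul, smul_inv_smul₀ hr.ne', Fintype.linearCombination_apply]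

section Lift

variable {ι : Type*}

/-- The nonnegative vector with fractional part `q.1` and integral part `q.2`. -/
def lift (q : (ι → UnitAddCircle) × (ι →₀ ℕ)) : ι → ℝ := fun i => fracPart (q.1 i) + q.2 i

theorem coe_lift (q : (ι → UnitAddCircle) × (ι →₀ ℕ)) :
    (fun i => (lift q i : UnitAddCircle)) = q.1 := by
  ext i
  rw [lift, AddCircle.coe_add, coe_fracPart, add_eq_left, AddCircle.coe_eq_zero_iff]
  exact ⟨q.2 i, by simp⟩

theorem lift_injective : Function.Injective (lift (ι := ι)) := by
  rintro ⟨θ, f⟩ ⟨η, g⟩ h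
  obtain rfl : θ = η := by
    simpa only [coe_lift] using congrArg (fun t i => ((t i : ℝ) : UnitAddCircle)) h
  refine Prod.ext rfl (Finsupp.ext fun i => ?_)
  have := congrFun h i
  simp only [lift, add_right_inj] at this
  exact_mod_cast this

theorem exists_lift_eq [Finite ι] {t : ι → ℝ} (ht : ∀ i, 0 ≤ t i) : ∃ q, lift q = t := by
  refine ⟨(fun i => t i, Finsupp.equivFunOnFinite.symm fun i => ⌊t i⌋₊), funext fun i => ?_⟩
  simp [lift, natCast_floor_eq_intCast_floor (ht i)]

theorem sum_lift [Fintype ι] (q : (ι → UnitAddCircle) × (ι →₀ ℕ)) :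
    ∑ i, lift q i = height q.1 + ∑ i, (q.2 i : ℝ) := by
  simp only [lift, Finset.sum_add_distrib, height]

theorem natFloor_height [Fintype ι] {θ : ι → UnitAddCircle} (hθ : ∑ i, θ i = 0) :
    (⌊height θ⌋₊ : ℝ) = height θ := by
  have hcoe : (height θ : UnitAddCircle) = 0 := by
    have := map_sum (QuotientAddGroup.mk' (AddSubgroup.zmultiples (1 : ℝ)))
      (fun i => fracPart (θ i)) Finset.univ
    exact this.trans ((Finset.sum_congr rfl fun i _ => coe_fracPart (θ i)).trans hθ)
  obtain ⟨z, hz⟩ := (AddCircle.coe_eq_zero_iff 1).1 hcoe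
  have hnonneg := height_nonneg θ
  rw [zsmul_one] at hz
  rw [← hz] at hnonneg ⊢
  lift z to ℕ using by exact_mod_cast hnonneg
  simp

/-- The vectors of the cone `[0, ∞)^ι` of sum `n` with class in `G`. For `G = simplexGroup v` they
are the barycentric coordinates of the lattice points in the `n`-th dilate of the simplex. -/
def nonnegLifts [Fintype ι] (G : AddSubgroup (ι → UnitAddCircle)) (n : ℕ) : Set (ι → ℝ) :=
  {t | (fun i => (t i : UnitAddCircle)) ∈ G ∧ (∀ i, 0 ≤ t i) ∧ ∑ i, t i = n}

theorem nonnegLifts_zero [Fintype ι] (G : AddSubgroup (ι → UnitAddCircle)) :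
    nonnegLifts G 0 = {0} := by
  ext t
  rw [Set.mem_singleton_iff]
  constructor
  · rintro ⟨-, ht, hsum⟩
    rw [Nat.cast_zero, Fintype.sum_eq_zero_iff_of_nonneg ht] at hsum
    exact hsum
  · rintro rfl
    exact ⟨zero_mem G, fun _ => le_rfl, by simp⟩

theorem nonnegLifts_eq_image_lift [Fintype ι] [DecidableEq ι]
    {G : AddSubgroup (ι → UnitAddCircle)} (hsum : ∀ θ ∈ G, ∑ i, θ i = 0) (n : ℕ) :
    nonnegLifts G n = lift '' {q | q.1 ∈ G ∧ ⌊height q.1⌋₊ ≤ n ∧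
      q.2 ∈ Finset.finsuppAntidiag Finset.univ (n - ⌊height q.1⌋₊)} := by
  have hlift (q : (ι → UnitAddCircle) × (ι →₀ ℕ)) : lift q ∈ nonnegLifts G n ↔
      q.1 ∈ G ∧ ⌊height q.1⌋₊ ≤ n ∧ ∑ i, q.2 i = n - ⌊height q.1⌋₊ := by
    have hpos (i : ι) : 0 ≤ lift q i := add_nonneg (fracPart_nonneg _) (Nat.cast_nonneg _)
    simp only [nonnegLifts, Set.mem_ofPred_eq, coe_lift, sum_lift, hpos, implies_true, true_and]
    refine and_congr_right fun hq => ?_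
    have hfloor := natFloor_height (hsum _ hq)
    generalize ⌊height q.1⌋₊ = m at hfloor ⊢
    rw [← hfloor]
    norm_cast
    omega
  ext t
  simp only [Set.mem_image, Set.mem_ofPred_eq, Finset.mem_finsuppAntidiag, Finset.subset_univ,
    and_true]
  constructor
  · intro ht
    obtain ⟨q, rfl⟩ := exists_lift_eq ht.2.1
    exact ⟨q, (hlift q).1 ht, rfl⟩
  · rintro ⟨q, hq, rfl⟩
    exact (hlift q).2 hq

theorem ncard_nonnegLifts {d : ℕ} {G : AddSubgroup (Fin (d + 1) → UnitAddCircle)}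
    (hfin : (G : Set (Fin (d + 1) → UnitAddCircle)).Finite) (hsum : ∀ θ ∈ G, ∑ i, θ i = 0)
    (n : ℕ) :
    (nonnegLifts G n).ncard = ∑ θ ∈ hfin.toFinset,
      if ⌊height θ⌋₊ ≤ n then (d + (n - ⌊height θ⌋₊)).choose d else 0 := by
  classical
  let T : Finset (Σ _ : Fin (d + 1) → UnitAddCircle, Fin (d + 1) →₀ ℕ) :=
    (hfin.toFinset.filter fun θ => ⌊height θ⌋₊ ≤ n).sigma fun θ =>
      Finset.finsuppAntidiag Finset.univ (n - ⌊height θ⌋₊)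
  have hT : {q : (Fin (d + 1) → UnitAddCircle) × (Fin (d + 1) →₀ ℕ) |
      q.1 ∈ G ∧ ⌊height q.1⌋₊ ≤ n ∧
        q.2 ∈ Finset.finsuppAntidiag Finset.univ (n - ⌊height q.1⌋₊)} =
      Equiv.sigmaEquivProd (Fin (d + 1) → UnitAddCircle) (Fin (d + 1) →₀ ℕ) ''
        (T : Set (Σ _ : Fin (d + 1) → UnitAddCircle, Fin (d + 1) →₀ ℕ)) := by
    ext q
    rw [Equiv.image_eq_preimage_symm]
    simp [T, and_assoc, Equiv.sigmaEquivProd]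
  rw [nonnegLifts_eq_image_lift hsum, lift_injective.injOn.ncard_image, hT,
    (Equiv.injective _).injOn.ncard_image, Set.ncard_coe_finset, Finset.card_sigma,
    Finset.sum_filter]
  refine Finset.sum_congr rfl fun θ _ => ?_
  rw [Finset.card_finsuppAntidiag_nat_eq_choose, Finset.card_univ, Fintype.card_fin,
    Nat.add_right_comm, Nat.add_sub_cancel, Nat.choose_symm_add]

end Lift

theorem latticeCount_convexHull {d : ℕ} {v : Fin (d + 1) → Fin d → ℤ}
    (hv : AffineIndependent ℝ fun i => toReal (v i)) {n : ℕ} (hn : 0 < n) :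
    latticeCount (convexHull ℝ (Set.range fun i => toReal (v i))) n =
      (nonnegLifts (simplexGroup v) n).ncard := by
  have hn' : (0 : ℝ) < n := Nat.cast_pos.2 hn
  have hinj : Set.InjOn (fun t => ∑ i, t i • toReal (v i)) (nonnegLifts (simplexGroup v) n) := by
    rintro t ⟨-, -, ht⟩ u ⟨-, -, hu⟩ htu
    refine sub_eq_zero.1 (funext fun i => affineIndependent_iff.1 hv Finset.univ (t - u) ?_ ?_ i
      (Finset.mem_univ i))
    · simp [ht, hu]
    · simpa [sub_smul, sub_eq_zero] using htu
  rw [latticeCount, ← hinj.ncard_image]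
  congr 1
  ext x
  simp only [Set.mem_inter_iff, mem_smul_convexHull_range_iff _ hn', nonnegLifts,
    coe_mem_simplexGroup, Set.mem_range, Set.mem_image, Set.mem_ofPred_eq]
  constructor
  · rintro ⟨⟨t, ht, hsum, rfl⟩, z, hz⟩
    exact ⟨t, ⟨⟨⟨n, by simp [hsum]⟩, z, hz.symm⟩, ht, hsum⟩, rfl⟩
  · rintro ⟨t, ⟨⟨-, z, hz⟩, ht, hsum⟩, rfl⟩
    exact ⟨⟨t, ht, hsum, rfl⟩, z, hz.symm⟩

theorem finite_simplexGroup {d : ℕ} {v : Fin (d + 1) → Fin d → ℤ}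
    (hv : AffineIndependent ℝ fun i => toReal (v i)) :
    (simplexGroup v : Set (Fin (d + 1) → UnitAddCircle)).Finite :=
  finite_relationGroup (affineIndependent_iff_det_homogenization_ne_zero.1 hv)

theorem deltaSeries_convexHull {d : ℕ} {v : Fin (d + 1) → Fin d → ℤ}
    (hv : AffineIndependent ℝ fun i => toReal (v i)) :
    deltaSeries (convexHull ℝ (Set.range fun i => toReal (v i))) =
      ∑ θ ∈ (finite_simplexGroup hv).toFinset,
        (PowerSeries.X : PowerSeries ℤ) ^ ⌊height θ⌋₊ := by
  set P := convexHull ℝ (Set.range fun i => toReal (v i))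
  have hcount : (PowerSeries.mk fun n => if n = 0 then 1 else (latticeCount P n : ℤ)) =
      (∑ θ ∈ (finite_simplexGroup hv).toFinset, (PowerSeries.X : PowerSeries ℤ) ^ ⌊height θ⌋₊) *
        PowerSeries.mk fun n => ((d + n).choose d : ℤ) := by
    ext n
    have hn : (if n = 0 then 1 else (latticeCount P n : ℤ)) =
        (nonnegLifts (simplexGroup v) n).ncard := by
      split_ifs with h
      · rw [h, nonnegLifts_zero, Set.ncard_singleton, Nat.cast_one]
      · rw [latticeCount_convexHull hv (Nat.pos_of_ne_zero h)]
    rw [PowerSeries.coeff_mk, hn, ncard_nonnegLifts (finite_simplexGroup hv)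
      fun θ hθ => (mem_simplexGroup.1 hθ).1, Finset.sum_mul, map_sum]
    push_cast
    refine Finset.sum_congr rfl fun x _ => ?_
    rw [PowerSeries.coeff_X_pow_mul', PowerSeries.coeff_mk]
  rw [deltaSeries, hcount, mul_comm, mul_assoc, PowerSeries.mk_add_choose_mul_one_sub_pow_eq_one,
    mul_one]

theorem bijOn_of_sum_X_pow_eq {α : Type*} {s : Finset α} {f : α → ℕ} {t : Finset ℕ}
    (h : ∑ x ∈ s, (PowerSeries.X : PowerSeries ℤ) ^ f x = ∑ n ∈ t, PowerSeries.X ^ n) :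
    Set.BijOn f s t := by
  have hcard (n : ℕ) : (s.filter fun x => f x = n).card = if n ∈ t then 1 else 0 := by
    rw [← Finset.card_singleton n, ← Finset.card_empty, ← apply_ite Finset.card,
      ← Finset.filter_eq']
    have := congrArg (PowerSeries.coeff n) h
    simp only [map_sum, PowerSeries.coeff_X_pow, Finset.sum_boole, eq_comm (a := n)] at this
    exact_mod_cast this
  have hmem (x : α) (hx : x ∈ s) : f x ∈ t := by
    by_contra hxt
    have := hcard (f x)
    rw [if_neg hxt, Finset.card_eq_zero] at this
    exact Finset.notMem_empty x (this ▸ Finset.mem_filter.2 ⟨hx, rfl⟩)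
  refine ⟨hmem, fun x hx y hy hxy => ?_, fun n hn => ?_⟩
  · exact Finset.card_le_one.1 (((hcard (f y)).trans (if_pos (hmem y hy))).le) x
      (Finset.mem_filter.2 ⟨hx, hxy⟩) y (Finset.mem_filter.2 ⟨hy, rfl⟩)
  · obtain ⟨x, hx⟩ := Finset.card_eq_one.1 ((hcard n).trans (if_pos hn))
    exact ⟨x, Finset.mem_filter.1 (hx ▸ Finset.mem_singleton_self x)⟩

theorem exists_bijOn_height {d : ℕ} {v : Fin (d + 1) → Fin d → ℤ}
    (hv : AffineIndependent ℝ fun i => toReal (v i)) {N m : ℕ} (hm : 0 < m)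
    (hδ : deltaSeries (convexHull ℝ (Set.range fun i => toReal (v i))) =
      ∑ i ∈ Finset.range N, (PowerSeries.X : PowerSeries ℤ) ^ (i * m)) :
    ∃ h : simplexGroup v → ℕ, Set.BijOn h Set.univ (Set.Iio N) ∧ ∀ θ, height θ.1 = h θ * m := by
  have hinj : Function.Injective fun i => i * m := mul_left_injective₀ hm.ne'
  have hbij : Set.BijOn (fun θ => ⌊height θ⌋₊)
      (simplexGroup v : Set (Fin (d + 1) → UnitAddCircle)) ((· * m) '' Set.Iio N) := by
    rw [deltaSeries_convexHull hv, ← Finset.sum_image (f := fun n => PowerSeries.X ^ n)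
      hinj.injOn] at hδ
    simpa using bijOn_of_sum_X_pow_eq hδ
  choose h hN hh using fun θ : simplexGroup v => hbij.mapsTo θ.2
  replace hh (θ : simplexGroup v) : h θ * m = ⌊height θ.1⌋₊ := hh θ
  refine ⟨h, ⟨fun θ _ => hN θ, fun θ _ η _ hθη => ?_, fun i hi => ?_⟩, fun θ => ?_⟩
  · refine Subtype.ext (hbij.injOn θ.2 η.2 ?_)
    simp only [← hh, hθη]
  · obtain ⟨θ, hθ, hi⟩ := hbij.surjOn (Set.mem_image_of_mem (· * m) hi)
    exact ⟨⟨θ, hθ⟩, Set.mem_univ _, hinj ((hh ⟨θ, hθ⟩).trans hi)⟩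
  · rw [← natFloor_height (mem_simplexGroup.1 θ.2).1, ← hh θ, Nat.cast_mul]

end DeltaSeries

section Pyramid

/-- A basis of `ker φ`, completed by `y`, is a basis of the lattice. -/
theorem exists_linearEquiv_apply_last {d : ℕ} (φ : (Fin (d + 1) → ℤ) →ₗ[ℤ] ℤ)
    {y : Fin (d + 1) → ℤ} (hy : φ y = 1) :
    ∃ e : (Fin (d + 1) → ℤ) ≃ₗ[ℤ] (Fin (d + 1) → ℤ),
      (∀ x, e x (Fin.last d) = φ x) ∧ e y = Pi.single (Fin.last d) 1 := by
  obtain ⟨n, b⟩ := Submodule.basisOfPid (Pi.basisFun ℤ (Fin (d + 1))) (LinearMap.ker φ)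
  let B := Module.Basis.mkFinSnoc b y
    (fun c x hx h => by
      simpa only [map_add, map_smul, map_zero, hy, LinearMap.mem_ker.1 hx, smul_eq_mul, mul_one,
        add_zero] using congrArg φ h)
    (fun z => ⟨-φ z, by
      rw [LinearMap.mem_ker, map_add, map_smul, hy, smul_eq_mul, mul_one, add_neg_cancel]⟩)
  obtain rfl : n = d := by
    simpa using (Module.finrank_eq_card_basis B).symm.trans
      (Module.finrank_eq_card_basis (Pi.basisFun ℤ (Fin (d + 1))))
  have hB_last : B (Fin.last n) = y := by simp [B]
  have hcoord : B.coord (Fin.last n) = φ := by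
    refine B.ext (Fin.lastCases ?_ fun k => ?_)
    · rw [Module.Basis.coord_apply, Module.Basis.repr_self, Finsupp.single_eq_same, hB_last, hy]
    · have hB : B k.castSucc = b k := by simp [B]
      rw [Module.Basis.coord_apply, Module.Basis.repr_self, hB, LinearMap.mem_ker.1 (b k).2,
        Finsupp.single_eq_of_ne k.castSucc_ne_last.symm]
  refine ⟨B.equivFun, fun x => LinearMap.congr_fun hcoord x, ?_⟩
  rw [← hB_last]
  ext k
  simp [Pi.single_apply, eq_comm]

theorem exists_isUnit_det_vecMul_apply_last {d : ℕ} (φ : (Fin (d + 1) → ℤ) →ₗ[ℤ] ℤ)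
    {y : Fin (d + 1) → ℤ} (hy : φ y = 1) :
    ∃ U : Matrix (Fin (d + 1)) (Fin (d + 1)) ℤ, IsUnit U.det ∧
      (∀ x, (x ᵥ* U) (Fin.last d) = φ x) ∧ y ᵥ* U = Pi.single (Fin.last d) 1 := by
  obtain ⟨e, he, hey⟩ := exists_linearEquiv_apply_last φ hy
  have hU (x : Fin (d + 1) → ℤ) : x ᵥ* (LinearMap.toMatrix' e.toLinearMap)ᵀ = e x := by
    rw [Matrix.vecMul_transpose, LinearMap.toMatrix'_mulVec]
    rfl
  refine ⟨(LinearMap.toMatrix' e.toLinearMap)ᵀ, ?_, fun x => by rw [hU, he], by rw [hU, hey]⟩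
  rw [Matrix.det_transpose, LinearMap.det_toMatrix']
  exact e.isUnit_det'

/-- The inclusion of `ℝ^d` in `ℝ^(d + 1)` as the hyperplane where the last coordinate vanishes. -/
def snocZero (d : ℕ) : (Fin d → ℝ) →ₗ[ℝ] (Fin (d + 1) → ℝ) where
  toFun x := Fin.snoc (α := fun _ => ℝ) x 0
  map_add' x y := by ext k; refine Fin.lastCases ?_ (fun k => ?_) k <;> simp
  map_smul' c x := by ext k; refine Fin.lastCases ?_ (fun k => ?_) k <;> simp

theorem snocZero_toReal_init {d : ℕ} {x : Fin (d + 1) → ℤ} (hx : x (Fin.last d) = 0) :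
    snocZero d (toReal (Fin.init (α := fun _ => ℤ) x)) = toReal x := by
  ext k
  refine Fin.lastCases ?_ (fun k => ?_) k <;> simp [snocZero, toReal, hx, Fin.init]

theorem pyramid_convexHull {d : ℕ} (s : Set (Fin d → ℝ)) :
    pyramid (convexHull ℝ s) =
      convexHull ℝ (insert (Pi.single (Fin.last d) 1) (snocZero d '' s)) := by
  have hapex : Fin.snoc (α := fun _ => ℝ) (0 : Fin d → ℝ) 1 = Pi.single (Fin.last d) 1 := by
    ext k
    refine Fin.lastCases ?_ (fun k => ?_) k <;> simp [Fin.castSucc_ne_last]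
  calc pyramid (convexHull ℝ s)
      = convexHull ℝ ({Pi.single (Fin.last d) 1} ∪ snocZero d '' convexHull ℝ s) := by
        rw [pyramid, hapex]
        rfl
    _ = _ := by
        rw [(snocZero d).image_convexHull, convexHull_convexHull_union_right, Set.insert_eq]

theorem exists_pyramid_eq_convexHull {d : ℕ} {w : Fin (d + 2) → Fin (d + 1) → ℤ}
    (hw : AffineIndependent ℝ fun j => toReal (w j)) {i : Fin (d + 2)}
    (hapex : w i = Pi.single (Fin.last d) 1)
    (hbase : ∀ j, w (i.succAbove j) (Fin.last d) = 0) :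
    ∃ Q, IsLatticeSimplex Q ∧ pyramid Q = convexHull ℝ (Set.range fun j => toReal (w j)) := by
  let q (j : Fin (d + 1)) : Fin d → ℤ := Fin.init (α := fun _ => ℤ) (w (i.succAbove j))
  have hq (j : Fin (d + 1)) : snocZero d (toReal (q j)) = toReal (w (i.succAbove j)) :=
    snocZero_toReal_init (hbase j)
  refine ⟨_, ⟨q, .of_comp (snocZero d).toAffineMap ?_, rfl⟩, ?_⟩
  · have hcomp : snocZero d ∘ (fun j => toReal (q j)) =
        (fun j => toReal (w j)) ∘ i.succAboveEmb := funext hq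
    rw [LinearMap.coe_toAffineMap, hcomp]
    exact hw.comp_embedding i.succAboveEmb
  · have hapex' : toReal (w i) = Pi.single (Fin.last d) 1 := by
      ext k
      simp [hapex, toReal, Pi.single_apply]
    rw [pyramid_convexHull, ← Set.range_comp, ← hapex']
    simp only [Function.comp_def, hq]
    rw [← Function.comp_def (fun j => toReal (w j)), Set.range_comp, Fin.range_succAbove,
      ← Set.image_insert_eq (f := fun j => toReal (w j)), Set.insert_eq, Set.union_compl_self,
      Set.image_univ]

theorem exists_affine_eq_single_of_simplexGroup {d : ℕ} {v : Fin (d + 1) → Fin d → ℤ}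
    (hv : AffineIndependent ℝ fun i => toReal (v i)) {i : Fin (d + 1)}
    (hi : ∀ θ ∈ simplexGroup v, θ i = 0) :
    ∃ (φ : (Fin d → ℤ) →ₗ[ℤ] ℤ) (c : ℤ), ∀ j, φ (v j) + c = if j = i then 1 else 0 := by
  obtain ⟨W, hW⟩ := exists_eq_mul_of_relationGroup_le
    (affineIndependent_iff_det_homogenization_ne_zero.1 hv)
    (N := Matrix.of fun j (_ : Unit) => if j = i then 1 else 0)
    fun θ hθ => mem_relationGroup.2 fun _ => by simpa using hi θ hθ
  refine ⟨Fintype.linearCombination ℤ fun k => W k.succ (), W 0 (), fun j => ?_⟩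
  have := congrFun₂ hW j ()
  rw [Matrix.mul_apply, Fin.sum_univ_succ] at this
  simpa [homogenization, Fintype.linearCombination_apply, add_comm] using this.symm

theorem isLatticePyramid_of_simplexGroup_apply_eq_zero {d : ℕ}
    {v : Fin (d + 2) → Fin (d + 1) → ℤ} (hv : AffineIndependent ℝ fun i => toReal (v i))
    {i : Fin (d + 2)} (hi : ∀ θ ∈ simplexGroup v, θ i = 0) :
    IsLatticePyramid (convexHull ℝ (Set.range fun i => toReal (v i))) := by
  obtain ⟨φ, c, hφ⟩ := exists_affine_eq_single_of_simplexGroup hv hi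
  obtain ⟨i₀, hi₀⟩ := exists_ne i
  have hφ_sub (j : Fin (d + 2)) : φ (v j - v i₀) = if j = i then 1 else 0 := by
    rw [map_sub, ← hφ j, eq_neg_of_add_eq_zero_left ((hφ i₀).trans (if_neg hi₀)), sub_neg_eq_add]
  obtain ⟨U, hU, hU_last, hU_apex⟩ :=
    exists_isUnit_det_vecMul_apply_last φ ((hφ_sub i).trans (if_pos rfl))
  have hw (j : Fin (d + 2)) : v j ᵥ* U + -(v i₀ ᵥ* U) = (v j - v i₀) ᵥ* U := by
    rw [Matrix.sub_vecMul, sub_eq_add_neg]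
  obtain ⟨Q, hQ, hpyramid⟩ := exists_pyramid_eq_convexHull
    (w := fun j => v j ᵥ* U + -(v i₀ ᵥ* U)) (i := i)
    (by simpa only [Function.comp_def, latticeAffineMap_toReal] using
      hv.map' _ (latticeAffineMap_injective hU (-(v i₀ ᵥ* U))))
    (by rw [hw, hU_apex])
    (fun j => by rw [hw, hU_last, hφ_sub, if_neg (i.succAbove_ne j)])
  exact ⟨Q, hQ, hpyramid ▸ unimodularlyEquivalent_convexHull v hU _⟩

end Pyramid

section RowSimplex

/-- The vertices of `rowSimplex M`: the origin, followed by the rows of `M`. -/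
def rowVertices {d : ℕ} (M : Matrix (Fin d) (Fin d) ℤ) : Fin (d + 1) → Fin d → ℤ := Fin.cons 0 M

@[simp]
theorem rowVertices_zero {d : ℕ} (M : Matrix (Fin d) (Fin d) ℤ) : rowVertices M 0 = 0 := rfl

@[simp]
theorem rowVertices_succ {d : ℕ} (M : Matrix (Fin d) (Fin d) ℤ) (i : Fin d) :
    rowVertices M i.succ = M i := rfl

theorem rowSimplex_eq_convexHull {d : ℕ} (M : Matrix (Fin d) (Fin d) ℤ) :
    rowSimplex M = convexHull ℝ (Set.range fun i => toReal (rowVertices M i)) := by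
  have hzero : toReal (0 : Fin d → ℤ) = 0 := funext fun _ => Int.cast_zero
  rw [rowSimplex, ← hzero]
  congr 1
  ext x
  simp [Fin.exists_fin_succ, eq_comm]

theorem det_homogenization_rowVertices {d : ℕ} (M : Matrix (Fin d) (Fin d) ℤ) :
    (homogenization (rowVertices M)).det = M.det := by
  have hminor : (homogenization (rowVertices M)).submatrix Fin.succ (Fin.succAbove 0) = M := by
    ext i j
    simp only [homogenization, Matrix.submatrix_apply, Fin.succAbove_zero, Matrix.of_apply,
      Fin.cons_succ, rowVertices_succ]
  rw [Matrix.det_succ_row_zero, Fin.sum_univ_succ, hminor]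
  simp [homogenization]

theorem affineIndependent_rowVertices {d : ℕ} {M : Matrix (Fin d) (Fin d) ℤ} (hM : M.det ≠ 0) :
    AffineIndependent ℝ fun i => toReal (rowVertices M i) := by
  rwa [affineIndependent_iff_det_homogenization_ne_zero, det_homogenization_rowVertices]

theorem mem_simplexGroup_rowVertices {d : ℕ} {M : Matrix (Fin d) (Fin d) ℤ}
    {θ : Fin (d + 1) → UnitAddCircle} :
    θ ∈ simplexGroup (rowVertices M) ↔ ∑ i, θ i = 0 ∧ ∀ j, ∑ i, M i j • θ i.succ = 0 := by
  simp [mem_simplexGroup, Fin.sum_univ_succ (n := d)]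

theorem eq_zero_of_sum_eq_zero {G : Type*} [AddCommGroup G] {d : ℕ} {θ : Fin (d + 1) → G}
    (hsum : ∑ i, θ i = 0) (hsucc : ∀ i : Fin d, θ i.succ = 0) : θ = 0 := by
  refine funext (Fin.cases ?_ hsucc)
  simpa [Fin.sum_univ_succ, hsucc] using hsum

end RowSimplex

section SimplexA

variable {n : ℕ}

theorem matrixA_castSucc (A : Fin (n + 1) → ℤ) (i : Fin n) :
    matrixA A i.castSucc = Pi.single i.castSucc 1 := by
  ext j
  simp [matrixA, Pi.single_apply, i.isLt.ne]

theorem matrixA_last (A : Fin (n + 1) → ℤ) (j : Fin (n + 1)) :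
    matrixA A (Fin.last n) j =
      if j = Fin.last n then A (Fin.last n) else A (Fin.last n) - A j := by
  simp [matrixA]

theorem det_matrixA (A : Fin (n + 1) → ℤ) : (matrixA A).det = A (Fin.last n) := by
  have htriangular : (matrixA A).BlockTriangular OrderDual.toDual := by
    intro i j hij
    have hij : i < j := hij
    obtain ⟨i, rfl⟩ := Fin.exists_castSucc_eq.2 (hij.trans_le j.le_last).ne
    rw [matrixA_castSucc, Pi.single_eq_of_ne hij.ne']
  rw [Matrix.det_of_isLowerTriangular _ htriangular, Fin.prod_univ_castSucc, matrixA_last]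
  simp [matrixA_castSucc]

theorem mem_simplexGroup_matrixA {A : Fin (n + 1) → ℤ} {θ : Fin (n + 2) → UnitAddCircle} :
    θ ∈ simplexGroup (rowVertices (matrixA A)) ↔
      ∑ i, θ i = 0 ∧ A (Fin.last n) • θ (Fin.last (n + 1)) = 0 ∧
        ∀ j : Fin n, θ j.castSucc.succ = A j.castSucc • θ (Fin.last (n + 1)) := by
  have hlast : ∑ i, matrixA A i (Fin.last n) • θ i.succ =
      A (Fin.last n) • θ (Fin.last (n + 1)) := by
    simp [Fin.sum_univ_castSucc (n := n), matrixA_castSucc, matrixA_last]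
  have hcastSucc (j : Fin n) : ∑ i, matrixA A i j.castSucc • θ i.succ =
      θ j.castSucc.succ + (A (Fin.last n) - A j.castSucc) • θ (Fin.last (n + 1)) := by
    simp [Fin.sum_univ_castSucc (n := n), matrixA_castSucc, matrixA_last, Pi.single_apply]
  rw [mem_simplexGroup_rowVertices, Fin.forall_fin_succ', hlast, and_comm (b := _ = _)]
  refine and_congr_right fun _ => and_congr_right fun hzero => forall_congr' fun j => ?_
  rw [hcastSucc, sub_smul, hzero, zero_sub, add_neg_eq_zero]

theorem simplexGroup_matrixA_snoc {q : ℕ} (hq : 0 < q) (a : Fin n → ℤ)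
    {u : Fin (n + 2) → UnitAddCircle} (hsum : ∑ i, u i = 0)
    (hlast : u (Fin.last (n + 1)) = unitFrac q)
    (hu : ∀ j : Fin n, u j.castSucc.succ = a j • unitFrac q) :
    simplexGroup (rowVertices (matrixA (Fin.snoc a (q : ℤ)))) = AddSubgroup.zmultiples u := by
  have hmem : u ∈ simplexGroup (rowVertices (matrixA (Fin.snoc a (q : ℤ)))) :=
    mem_simplexGroup_matrixA.2 ⟨hsum, by simp [hlast], fun j => by simp [hlast, hu]⟩
  refine le_antisymm (fun θ hθ => ?_) (AddSubgroup.zmultiples_le_of_mem hmem)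
  obtain ⟨c, -, hc⟩ : ∃ c < q, θ (Fin.last (n + 1)) = c • unitFrac q :=
    exists_eq_nsmul_unitFrac hq (by simpa using (mem_simplexGroup_matrixA.1 hθ).2.1)
  obtain ⟨hsum_sub, -, hsub⟩ := mem_simplexGroup_matrixA.1 (sub_mem hθ (nsmul_mem hmem c))
  have hlast_sub : (θ - c • u) (Fin.last (n + 1)) = 0 := by simp [hc, hlast]
  have : θ - c • u = 0 := eq_zero_of_sum_eq_zero hsum_sub <| Fin.lastCases hlast_sub fun j => by
    rw [hsub, hlast_sub, smul_zero]
  exact sub_eq_zero.1 this ▸ nsmul_mem (AddSubgroup.mem_zmultiples u) c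

end SimplexA

section SimplexBC

variable {n : ℕ}

theorem det_matrixBC_ne_zero {t : ℕ} {B : Fin (t + 1) → ℤ} {C : Fin (n + 1) → ℤ}
    (hB : B (Fin.last t) ≠ 0) (hC : C (Fin.last n) ≠ 0) : (matrixBC B C).det ≠ 0 := by
  have htriangular : (matrixBC B C).IsLowerTriangular := by
    intro i j hij
    have hij : i < j := hij
    have : (i : ℕ) + 1 ≠ n + 1 := by omega
    simp only [matrixBC, Matrix.of_apply, this, hij.ne', if_false]
    split_ifs <;> omega
  rw [Matrix.det_of_isLowerTriangular _ htriangular, Finset.prod_ne_zero_iff]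
  intro i _
  simp only [matrixBC, Matrix.of_apply, if_true]
  split_ifs with hi hi
  · rwa [show i = Fin.last n from Fin.ext (Nat.succ_injective hi)]
  · rwa [show (⟨i, _⟩ : Fin (t + 1)) = Fin.last t from Fin.ext (Nat.succ_injective hi)]
  · exact one_ne_zero

/-- The matrix of `Δ(B, C)` for `B = (1, …, 1, q)` and `C = (q, …, q, 1, …, 1, q)`, where `B` has
one entry more than `t : Fin n` and `C` starts with as many entries `q` as `B` has entries. -/
def blockMatrix (q : ℕ) (t : Fin n) : Matrix (Fin (n + 1)) (Fin (n + 1)) ℤ :=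
  matrixBC (Fin.snoc (fun _ : Fin t => 1) (q : ℤ) : Fin (t + 1) → ℤ)
    (Fin.snoc (fun j : Fin n => if j ≤ t then (q : ℤ) else 1) (q : ℤ) : Fin (n + 1) → ℤ)

theorem blockMatrix_castSucc_castSucc (q : ℕ) (t i j : Fin n) :
    blockMatrix q t i.castSucc j.castSucc =
      (if i = j then 1 else 0) + if i = t then (if j ≤ t then (q : ℤ) - 1 else 0) else 0 := by
  have hB (h : (j : ℕ) < t + 1) :
      (Fin.snoc (fun _ : Fin t => 1) (q : ℤ) : Fin (t + 1) → ℤ) ⟨j, h⟩ =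
        if j = t then (q : ℤ) else 1 := by
    simp only [Fin.snoc, Fin.ext_iff]
    split_ifs <;> first | rfl | omega
  have hBt (h : (t : ℕ) < t + 1) :
      (Fin.snoc (fun _ : Fin t => 1) (q : ℤ) : Fin (t + 1) → ℤ) ⟨t, h⟩ = q := by
    simp [Fin.snoc]
  rcases eq_or_ne i t with rfl | hit
  · simp only [blockMatrix, matrixBC, Matrix.of_apply, Fin.val_castSucc, Nat.succ_inj, i.isLt.ne,
      if_false, dite_true, hB, hBt, Fin.castSucc_inj, if_true]
    split_ifs <;> omega
  · simp [blockMatrix, matrixBC, i.isLt.ne, Fin.val_ne_of_ne hit, hit, eq_comm (a := j)]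

theorem blockMatrix_castSucc_last (q : ℕ) (t i : Fin n) :
    blockMatrix q t i.castSucc (Fin.last n) = 0 := by
  simp [blockMatrix, matrixBC, i.isLt.ne, (Fin.castSucc_ne_last i).symm]

theorem blockMatrix_last_castSucc (q : ℕ) (t j : Fin n) :
    blockMatrix q t (Fin.last n) j.castSucc = if j ≤ t then 0 else (q : ℤ) - 1 := by
  simp only [blockMatrix, matrixBC, Matrix.of_apply, Fin.val_last, Fin.castSucc_ne_last, if_true,
    if_false, Fin.snoc_last, Fin.snoc_castSucc]
  split_ifs <;> simp

theorem blockMatrix_last_last (q : ℕ) (t : Fin n) :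
    blockMatrix q t (Fin.last n) (Fin.last n) = q := by
  simp [blockMatrix, matrixBC]

theorem mem_simplexGroup_blockMatrix {q : ℕ} {t : Fin n} {θ : Fin (n + 2) → UnitAddCircle} :
    θ ∈ simplexGroup (rowVertices (blockMatrix q t)) ↔
      ∑ i, θ i = 0 ∧ q • θ (Fin.last (n + 1)) = 0 ∧ q • θ t.castSucc.succ = 0 ∧
        ∀ j : Fin n, θ j.castSucc.succ =
          if j ≤ t then θ t.castSucc.succ else θ (Fin.last (n + 1)) := by
  have hlast : ∑ i, blockMatrix q t i (Fin.last n) • θ i.succ = q • θ (Fin.last (n + 1)) := by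
    simp [Fin.sum_univ_castSucc (n := n), blockMatrix_castSucc_last, blockMatrix_last_last]
  have hcastSucc (j : Fin n) : ∑ i, blockMatrix q t i j.castSucc • θ i.succ =
      θ j.castSucc.succ +
        (q - 1 : ℤ) • if j ≤ t then θ t.castSucc.succ else θ (Fin.last (n + 1)) := by
    simp only [Fin.sum_univ_castSucc (n := n), blockMatrix_castSucc_castSucc,
      blockMatrix_last_castSucc, add_smul, Finset.sum_add_distrib, ite_smul, one_smul, zero_smul,
      Finset.sum_ite_eq', Finset.mem_univ, if_true, Fin.succ_last]
    split_ifs <;> simp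
  rw [mem_simplexGroup_rowVertices, Fin.forall_fin_succ', hlast, and_comm (b := _ = _)]
  refine and_congr_right fun _ => and_congr_right fun hzero => ?_
  simp only [hcastSucc]
  have hneg {x : UnitAddCircle} (hx : q • x = 0) : (q - 1 : ℤ) • x = -x := by
    rw [sub_smul, natCast_zsmul, hx, one_smul, zero_sub]
  constructor
  · intro h
    have ht : q • θ t.castSucc.succ = 0 := by
      simpa [sub_smul] using h t
    refine ⟨ht, fun j => add_neg_eq_zero.1 ?_⟩
    rw [← hneg (by split_ifs <;> assumption), h]
  · rintro ⟨ht, h⟩ j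
    rw [hneg (by split_ifs <;> assumption), h, add_neg_cancel]

theorem simplexGroup_blockMatrix {q : ℕ} (hq : 0 < q) {t : Fin n}
    {x y : Fin (n + 2) → UnitAddCircle} (hx_sum : ∑ i, x i = 0)
    (hy_sum : ∑ i, y i = 0)
    (hx : ∀ j : Fin (n + 1), x j.succ = if j ≤ t.castSucc then unitFrac q else 0)
    (hy : ∀ j : Fin (n + 1), y j.succ = if j ≤ t.castSucc then 0 else unitFrac q) :
    simplexGroup (rowVertices (blockMatrix q t)) = AddSubgroup.closure {x, y} := by
  have hx_last : x (Fin.last (n + 1)) = 0 := by rw [← Fin.succ_last, hx, if_neg (by simp)]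
  have hy_last : y (Fin.last (n + 1)) = unitFrac q := by
    rw [← Fin.succ_last, hy, if_neg (by simp)]
  have hx_mem : x ∈ simplexGroup (rowVertices (blockMatrix q t)) :=
    mem_simplexGroup_blockMatrix.2
      ⟨hx_sum, by simp [hx_last], by simp [hx], fun j => by simp [hx, hx_last]⟩
  have hy_mem : y ∈ simplexGroup (rowVertices (blockMatrix q t)) :=
    mem_simplexGroup_blockMatrix.2
      ⟨hy_sum, by simp [hy_last], by simp [hy], fun j => by simp [hy, hy_last]⟩
  refine le_antisymm (fun θ hθ => ?_) ((AddSubgroup.closure_le _).2 (Set.pair_subset hx_mem hy_mem))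
  obtain ⟨-, hlast, ht, -⟩ := mem_simplexGroup_blockMatrix.1 hθ
  obtain ⟨a, -, ha⟩ := exists_eq_nsmul_unitFrac hq ht
  obtain ⟨b, -, hb⟩ := exists_eq_nsmul_unitFrac hq hlast
  obtain ⟨hsum, -, -, hη⟩ := mem_simplexGroup_blockMatrix.1
    (sub_mem (sub_mem hθ (nsmul_mem hx_mem a)) (nsmul_mem hy_mem b))
  have hη_t : (θ - a • x - b • y) t.castSucc.succ = 0 := by simp [ha, hx, hy]
  have hη_last : (θ - a • x - b • y) (Fin.last (n + 1)) = 0 := by simp [hb, hx_last, hy_last]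
  have hη_zero : θ - a • x - b • y = 0 :=
    eq_zero_of_sum_eq_zero hsum <| Fin.lastCases hη_last fun j => by
      rw [hη, hη_t, hη_last, ite_self]
  rw [sub_sub, sub_eq_zero] at hη_zero
  exact hη_zero ▸ add_mem (nsmul_mem (AddSubgroup.subset_closure (by simp)) a)
    (nsmul_mem (AddSubgroup.subset_closure (by simp)) b)

end SimplexBC

section Lists

theorem ofFn_snoc_const {α : Type*} (n : ℕ) (x y : α) :
    List.ofFn (Fin.snoc (fun _ => x) y : Fin (n + 1) → α) = List.replicate n x ++ [y] := by
  rw [List.ofFn_succ', List.concat_eq_append]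
  simp

theorem ofFn_snoc_ite {α : Type*} (r s : ℕ) (x y z : α) :
    List.ofFn (Fin.snoc (fun j : Fin (r + s) => if (j : ℕ) < r then x else y) z :
      Fin (r + s + 1) → α) = List.replicate r x ++ List.replicate s y ++ [z] := by
  simp only [List.ofFn_succ', List.concat_eq_append, Fin.snoc_castSucc, Fin.snoc_last,
    List.ofFn_add, Fin.val_castLE, Fin.val_natAdd, Fin.is_lt, if_true, Nat.not_lt, Nat.le_add_right,
    List.ofFn_const, if_neg]

end Lists

section Classification

variable {ι : Type*} [Fintype ι]

theorem height_const (x : UnitAddCircle) :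
    height (fun _ : ι => x) = Fintype.card ι * fracPart x := by
  simp [height]

theorem height_ite [DecidableEq ι] (S : Finset ι) (x y : UnitAddCircle) :
    height (fun i => if i ∈ S then x else y) =
      S.card * fracPart x + (Fintype.card ι - S.card : ℝ) * fracPart y := by
  rw [height, ← Finset.sum_add_sum_compl S, ← Nat.cast_sub S.card_le_univ, ← Finset.card_compl]
  congr 1
  · rw [Finset.sum_congr rfl fun i hi => by rw [if_pos hi], Finset.sum_const, nsmul_eq_mul]
  · rw [Finset.sum_congr rfl fun i hi => by rw [if_neg (Finset.mem_compl.1 hi)],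
      Finset.sum_const, nsmul_eq_mul]

theorem exists_generators_of_bijOn_height {G : AddSubgroup (ι → UnitAddCircle)} {p m : ℕ}
    (hp : p.Prime) (hm : 0 < m) {h : G → ℕ} (hbij : Set.BijOn h Set.univ (Set.Iio (p ^ 2)))
    (hh : ∀ θ, height θ.1 = h θ * m) :
    (∃ x, AddSubgroup.closure {x} = G ∧ p ^ 2 • x = 0 ∧
      ∀ a < p ^ 2, height (a • x) = a * m) ∨
    ∃ x y, AddSubgroup.closure {x, y} = G ∧ p • x = 0 ∧ (∃ j < p, j • x = p • y) ∧
      ∀ i < p, ∀ j < p, height (i • y + j • x) = (i * p + j : ℕ) * m := by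
  have hm' : (0 : ℝ) < m := Nat.cast_pos.2 hm
  have h_zero : h 0 = 0 := by
    simpa [hm'.ne'] using (hh 0).symm
  have h_add (θ η : G) : h (θ + η) ≤ h θ + h η := by
    have := height_add_le θ.1 η.1
    rw [← AddSubgroup.coe_add, hh, hh, hh, ← add_mul] at this
    exact_mod_cast le_of_mul_le_mul_right this hm'
  have hclosure {s : Set G} (hs : AddSubgroup.closure s = ⊤) :
      AddSubgroup.closure (G.subtype '' s) = G := by
    rw [← AddMonoidHom.map_closure, hs, ← AddMonoidHom.range_eq_map, G.range_subtype]
  refine (exists_generators_of_subadditive_bijOn hp h_zero h_add hbij).imp ?_ ?_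
  · rintro ⟨x, hx, hax, htop⟩
    refine ⟨x, ?_, congrArg Subtype.val hx, fun a ha => ?_⟩
    · simpa using hclosure ((AddSubgroup.zmultiples_eq_closure x).symm.trans htop)
    · simpa only [hax a ha, AddSubgroup.coe_nsmul] using hh (a • x)
  · rintro ⟨x, y, hx, ⟨j, hj, hjx⟩, hxy, htop⟩
    refine ⟨x, y, ?_, congrArg Subtype.val hx, ⟨j, hj, congrArg Subtype.val hjx⟩,
      fun a ha b hb => ?_⟩
    · simpa [Set.image_pair] using hclosure htop
    · simpa only [hxy a ha b hb, AddSubgroup.coe_add, AddSubgroup.coe_nsmul] using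
        hh (a • y + b • x)

theorem closure_pair_nsmul {M : Type*} [AddGroup M] (n : ℕ) (y : M) :
    AddSubgroup.closure {n • y, y} = AddSubgroup.zmultiples y :=
  le_antisymm
    ((AddSubgroup.closure_le _).2 (Set.pair_subset
      (nsmul_mem (AddSubgroup.mem_zmultiples y) n) (AddSubgroup.mem_zmultiples y)))
    (AddSubgroup.zmultiples_le_of_mem (AddSubgroup.subset_closure (by simp)))

theorem exists_mem_apply_ne_zero_of_closure {M : Type*} [AddGroup M] {κ : Type*}
    {s : Set (κ → M)} {i : κ} (h : ∃ θ ∈ AddSubgroup.closure s, θ i ≠ 0) : ∃ θ ∈ s, θ i ≠ 0 := by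
  contrapose! h
  exact (AddSubgroup.closure_le (Pi.evalAddMonoidHom (fun _ => M) i).ker).2 h

theorem eq_const_unitFrac_of_height_nsmul {q : ℕ} (hq : 0 < q) {x : ι → UnitAddCircle}
    (hx : q • x = 0) (hheight : height ((q - 1) • x) = (q - 1 : ℕ) * height x)
    (hne : ∀ i, x i ≠ 0) : x = fun _ => unitFrac q := by
  funext i
  refine (eq_zero_or_eq_unitFrac hq (congrFun hx i) ?_).resolve_left (hne i)
  rw [← Nat.cast_pred hq]
  refine lt_one_of_height_eq_sum (t := fun i => (q - 1 : ℕ) * fracPart (x i))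
    (fun i => mul_nonneg (Nat.cast_nonneg _) (fracPart_nonneg _)) ?_ i
  rw [← Finset.mul_sum, ← height, ← hheight]
  simp only [← nsmul_eq_mul, AddCircle.coe_nsmul, coe_fracPart]
  rfl

theorem eq_nsmul_unitFrac_sq {p j : ℕ} (hp : 1 < p) (hj : j < p) {y : UnitAddCircle}
    (hy : p • y = j • unitFrac p) (hlt : (p - 1) * (fracPart y + 1 / p) < 1) :
    j < 2 ∧ y = j • unitFrac (p ^ 2) := by
  have hp' : (2 : ℝ) ≤ p := by exact_mod_cast hp
  obtain ⟨a, ha, rfl⟩ : ∃ a < p ^ 2, y = a • unitFrac (p ^ 2) := by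
    refine exists_eq_nsmul_unitFrac (by positivity) ?_
    rw [sq, mul_smul, hy, smul_comm, nsmul_unitFrac_self, smul_zero]
  have ha2 : a < 2 := by
    rw [fracPart_nsmul_unitFrac ha] at hlt
    have : (p - 1 : ℝ) * (a + p) < p ^ 2 := by
      push_cast at hlt
      field_simp at hlt
      linarith
    have : (a : ℝ) < 2 := by
      by_contra! h2
      nlinarith
    exact_mod_cast this
  have haj : (a : ℝ) / p = j / p := by
    rw [← fracPart_nsmul_unitFrac hj, ← fracPart_nsmul_unitFrac (ha2.trans_le hp), ← hy,
      smul_comm, nsmul_unitFrac_sq]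
  obtain rfl : a = j := by
    rw [div_left_inj' (by positivity)] at haj
    exact_mod_cast haj
  exact ⟨ha2, rfl⟩

theorem exists_finset_eq_ite [DecidableEq ι] {p j : ℕ} (hp : 1 < p) (hj : j < p)
    {x y : ι → UnitAddCircle} (hx : p • x = 0) (hy : j • x = p • y)
    (hheight : height ((p - 1) • y + (p - 1) • x) = (p - 1 : ℕ) * (height y + height x))
    (hne : ∀ i, x i ≠ 0 ∨ y i ≠ 0) :
    ∃ S : Finset ι, (S.Nonempty → j < 2) ∧ (x = fun i => if i ∈ S then unitFrac p else 0) ∧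
      y = fun i => if i ∈ S then j • unitFrac (p ^ 2) else unitFrac p := by
  have hp0 : 0 < p := zero_lt_one.trans hp
  have hlt (i : ι) : (p - 1 : ℝ) * (fracPart (y i) + fracPart (x i)) < 1 := by
    rw [← Nat.cast_pred hp0]
    refine lt_one_of_height_eq_sum
      (t := fun i => (p - 1 : ℕ) * (fracPart (y i) + fracPart (x i))) (fun i => mul_nonneg
        (Nat.cast_nonneg _) (add_nonneg (fracPart_nonneg _) (fracPart_nonneg _))) ?_ i
    rw [← Finset.mul_sum, Finset.sum_add_distrib, ← height, ← height, ← hheight]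
    simp only [← nsmul_eq_mul, AddCircle.coe_nsmul, AddCircle.coe_add, coe_fracPart, nsmul_add]
    rfl
  have hx_cases (i : ι) : x i = 0 ∨ x i = unitFrac p := by
    refine eq_zero_or_eq_unitFrac hp0 (congrFun hx i) ((hlt i).trans_le' ?_)
    have : (1 : ℝ) < p := by exact_mod_cast hp
    exact mul_le_mul_of_nonneg_left (le_add_of_nonneg_left (fracPart_nonneg _)) (by linarith)
  have hy_of_zero {i : ι} (hi : x i = 0) : y i = unitFrac p := by
    have hpy : p • y i = 0 := by simpa [hi] using (congrFun hy i).symm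
    refine (eq_zero_or_eq_unitFrac hp0 hpy ?_).resolve_left ((hne i).resolve_left (· hi))
    simpa [hi] using hlt i
  have hy_of_unitFrac {i : ι} (hi : x i = unitFrac p) : j < 2 ∧ y i = j • unitFrac (p ^ 2) := by
    refine eq_nsmul_unitFrac_sq hp hj (hi ▸ (congrFun hy i).symm) ?_
    simpa [hi, fracPart_unitFrac hp] using hlt i
  refine ⟨Finset.univ.filter fun i => x i ≠ 0, ?_, funext fun i => ?_, funext fun i => ?_⟩
  · rintro ⟨i, hi⟩
    exact (hy_of_unitFrac ((hx_cases i).resolve_left (Finset.mem_filter.1 hi).2)).1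
  all_goals
    simp only [Finset.mem_filter, Finset.mem_univ, true_and]
    split_ifs with hi
  · exact (hx_cases i).resolve_left hi
  · exact not_not.1 hi
  · exact (hy_of_unitFrac ((hx_cases i).resolve_left hi)).2
  · exact hy_of_zero (not_not.1 hi)

theorem eq_const_and_card_of_height_nsmul {q m : ℕ} (hq : 1 < q) {x : ι → UnitAddCircle}
    (hx : q • x = 0) (hheight : ∀ a < q, height (a • x) = a * m) (hne : ∀ i, x i ≠ 0) :
    (x = fun _ => unitFrac q) ∧ Fintype.card ι = q * m := by
  have hq0 : 0 < q := zero_lt_one.trans hq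
  have hxm : height x = m := by simpa using hheight 1 hq
  have hconst : x = fun _ => unitFrac q :=
    eq_const_unitFrac_of_height_nsmul hq0 hx (by rw [hheight _ (Nat.sub_lt hq0 one_pos), hxm]) hne
  refine ⟨hconst, ?_⟩
  rw [hconst, height_const, fracPart_unitFrac hq, mul_one_div, div_eq_iff (by positivity),
    mul_comm] at hxm
  exact_mod_cast hxm

theorem exists_finset_eq_ite_and_card [DecidableEq ι] {p m j : ℕ} (hp : 1 < p) (hm : 0 < m)
    (hj : j < p) {x y : ι → UnitAddCircle} (hx : p • x = 0) (hy : j • x = p • y)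
    (hheight : ∀ a < p, ∀ b < p, height (a • y + b • x) = (a * p + b : ℕ) * m)
    (hne : ∀ i, x i ≠ 0 ∨ y i ≠ 0) :
    ∃ S : Finset ι, S.card = p * m ∧ (x = fun i => if i ∈ S then unitFrac p else 0) ∧
      (((y = fun i => if i ∈ S then unitFrac (p ^ 2) else unitFrac p) ∧
          Fintype.card ι = p * m + (p ^ 2 - 1) * m) ∨
        (y = fun i => if i ∈ S then 0 else unitFrac p) ∧
          Fintype.card ι = p * m + p ^ 2 * m) := by
  have hp0 : 0 < p := zero_lt_one.trans hp
  have hxm : height x = m := by simpa using hheight 0 hp0 1 hp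
  have hym : height y = p * m := by simpa using hheight 1 hp 0 hp0
  obtain ⟨S, hj2, hxS, hyS⟩ := exists_finset_eq_ite hp hj hx hy
    (by rw [hheight _ (Nat.sub_lt hp0 one_pos) _ (Nat.sub_lt hp0 one_pos), hxm, hym]
        push_cast; ring) hne
  rw [hxS, height_ite, fracPart_unitFrac hp, fracPart_zero, mul_zero, add_zero, mul_one_div,
    div_eq_iff (by positivity), mul_comm] at hxm
  have hS : S.card = p * m := by exact_mod_cast hxm
  refine ⟨S, hS, hxS, ?_⟩
  replace hj2 : j < 2 := hj2 (Finset.card_pos.1 (hS ▸ Nat.mul_pos hp0 hm))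
  rw [hyS, height_ite, fracPart_unitFrac hp, hxm] at hym
  interval_cases j
  · refine .inr ⟨by simpa using hyS, ?_⟩
    rw [zero_smul, fracPart_zero] at hym
    have : (Fintype.card ι : ℝ) = p * m + p ^ 2 * m := by
      field_simp at hym
      linarith
    exact_mod_cast this
  · refine .inl ⟨by simpa using hyS, ?_⟩
    rw [one_smul, fracPart_unitFrac (one_lt_pow₀ hp two_ne_zero)] at hym
    have : (Fintype.card ι : ℝ) + m = p * m + p ^ 2 * m := by
      push_cast at hym
      field_simp at hym
      linarith
    rw [Nat.sub_one_mul, ← Nat.add_sub_assoc (Nat.le_mul_of_pos_left m (by positivity))]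
    exact Nat.eq_sub_of_add_eq (by exact_mod_cast this)

theorem eq_zmultiples_or_eq_closure_of_bijOn_height [DecidableEq ι]
    {G : AddSubgroup (ι → UnitAddCircle)} {p m : ℕ} (hp : p.Prime) (hm : 0 < m) {h : G → ℕ}
    (hbij : Set.BijOn h Set.univ (Set.Iio (p ^ 2))) (hh : ∀ θ, height θ.1 = h θ * m)
    (hne : ∀ i, ∃ θ ∈ G, θ i ≠ 0) :
    (Fintype.card ι = p ^ 2 * m ∧ G = AddSubgroup.zmultiples fun _ => unitFrac (p ^ 2)) ∨
    (∃ S : Finset ι, S.card = p * m ∧ Fintype.card ι = p * m + (p ^ 2 - 1) * m ∧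
      G = AddSubgroup.zmultiples fun i => if i ∈ S then unitFrac (p ^ 2) else unitFrac p) ∨
    ∃ S : Finset ι, S.card = p * m ∧ Fintype.card ι = p * m + p ^ 2 * m ∧
      G = AddSubgroup.closure {fun i => if i ∈ S then unitFrac p else 0,
        fun i => if i ∈ S then 0 else unitFrac p} := by
  have hp1 : 1 < p := hp.one_lt
  rcases exists_generators_of_bijOn_height hp hm hbij hh with
    ⟨x, rfl, hx, hheight⟩ | ⟨x, y, rfl, hx, ⟨j, hj, hjx⟩, hheight⟩
  · obtain ⟨rfl, hcard⟩ := eq_const_and_card_of_height_nsmul (one_lt_pow₀ hp1 two_ne_zero) hx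
      hheight fun i => by simpa using exists_mem_apply_ne_zero_of_closure (hne i)
    exact .inl ⟨hcard, (AddSubgroup.zmultiples_eq_closure _).symm⟩
  · obtain ⟨S, hS, rfl, ⟨rfl, hcard⟩ | ⟨rfl, hcard⟩⟩ := exists_finset_eq_ite_and_card hp1 hm hj hx
      hjx hheight fun i => by simpa using exists_mem_apply_ne_zero_of_closure (hne i)
    · refine .inr (.inl ⟨S, hS, hcard, ?_⟩)
      set y : ι → UnitAddCircle := fun i => if i ∈ S then unitFrac (p ^ 2) else unitFrac p
      have hxy : (fun i => if i ∈ S then unitFrac p else 0) = p • y := by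
        funext i
        by_cases hi : i ∈ S <;> simp [y, hi]
      rw [hxy, closure_pair_nsmul]
    · exact .inr (.inr ⟨S, hS, hcard, rfl⟩)

end Classification

section VertexOrder

theorem exists_perm_mem_iff {α : Type*} [Finite α] {S T : Finset α} (h : S.card = T.card) :
    ∃ σ : Equiv.Perm α, ∀ i, σ i ∈ S ↔ i ∈ T := by
  classical
  let e : {i // i ∈ T} ≃ {i // i ∈ S} := Finset.equivOfCardEq h.symm
  exact ⟨e.extendSubtype, fun i =>
    ⟨fun hi => by_contra fun hn => e.extendSubtype_not_mem i hn hi, e.extendSubtype_mem i⟩⟩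

theorem simplexGroup_comp_perm {ι : Type*} [Fintype ι] {d : ℕ} (v : ι → Fin d → ℤ)
    (σ : Equiv.Perm ι) {s : Set (ι → UnitAddCircle)}
    (hs : simplexGroup v = AddSubgroup.closure s) :
    simplexGroup (v ∘ σ) = AddSubgroup.closure ((· ∘ σ) '' s) := by
  have hmap : simplexGroup (v ∘ σ) = (simplexGroup v).map
      (LinearMap.funLeft ℤ UnitAddCircle σ).toAddMonoidHom := by
    ext θ
    have hθ : (θ ∘ σ.symm) ∘ σ = θ := funext fun i => congrArg θ (σ.symm_apply_apply i)
    have hmem (η : ι → UnitAddCircle) : η ∘ σ ∈ simplexGroup (v ∘ σ) ↔ η ∈ simplexGroup v := by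
      simp only [mem_simplexGroup, Function.comp_apply, Equiv.sum_comp σ η,
        fun j => Equiv.sum_comp σ fun i => v i j • η i]
    refine ⟨fun h => ⟨θ ∘ σ.symm, (hmem _).1 (hθ.symm ▸ h), hθ⟩, ?_⟩
    rintro ⟨η, hη, rfl⟩
    exact (hmem η).2 hη
  rw [hmap, hs, AddMonoidHom.map_closure]
  rfl

theorem unimodularlyEquivalent_rowSimplex {d : ℕ} {v : Fin (d + 1) → Fin d → ℤ}
    (hv : AffineIndependent ℝ fun i => toReal (v i)) {M : Matrix (Fin d) (Fin d) ℤ}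
    (hM : M.det ≠ 0) (σ : Equiv.Perm (Fin (d + 1)))
    (h : simplexGroup (v ∘ σ) = simplexGroup (rowVertices M)) :
    UnimodularlyEquivalent (convexHull ℝ (Set.range fun i => toReal (v i))) (rowSimplex M) := by
  have hrange : (Set.range fun i => toReal ((v ∘ σ) i)) = Set.range fun i => toReal (v i) :=
    σ.surjective.range_comp fun i => toReal (v i)
  rw [rowSimplex_eq_convexHull, ← hrange]
  exact unimodularlyEquivalent_of_simplexGroup_eq (hv.comp_embedding σ.toEmbedding)
    (affineIndependent_rowVertices hM) h

end VertexOrder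

section NormalForms

variable {n : ℕ} {v : Fin (n + 2) → Fin (n + 1) → ℤ}

theorem unimodularlyEquivalent_simplexA_of_const {q : ℕ} (hq : 0 < q)
    (hv : AffineIndependent ℝ fun i => toReal (v i))
    (hG : simplexGroup v = AddSubgroup.zmultiples fun _ => unitFrac q) :
    UnimodularlyEquivalent (convexHull ℝ (Set.range fun i => toReal (v i)))
      (simplexA (Fin.snoc (fun _ : Fin n => 1) (q : ℤ))) := by
  have hmem : (fun _ => unitFrac q) ∈ simplexGroup v := hG ▸ AddSubgroup.mem_zmultiples _
  refine unimodularlyEquivalent_rowSimplex hv (by simp [det_matrixA, hq.ne']) (Equiv.refl _) ?_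
  exact hG.trans (simplexGroup_matrixA_snoc hq _ (mem_simplexGroup.1 hmem).1 rfl fun _ =>
    (one_smul ℤ _).symm).symm

theorem unimodularlyEquivalent_simplexA_of_ite {p r : ℕ} (hp : 0 < p) (hr : r ≤ n)
    (hv : AffineIndependent ℝ fun i => toReal (v i)) {S : Finset (Fin (n + 2))}
    (hS : S.card = r + 1)
    (hG : simplexGroup v =
      AddSubgroup.zmultiples fun i => if i ∈ S then unitFrac (p ^ 2) else unitFrac p) :
    UnimodularlyEquivalent (convexHull ℝ (Set.range fun i => toReal (v i)))
      (simplexA (Fin.snoc (fun j : Fin n => if (j : ℕ) < r then 1 else (p : ℤ))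
        ((p ^ 2 : ℕ) : ℤ))) := by
  let T : Finset (Fin (n + 2)) := (insert (Fin.last n)
    (Finset.univ.filter fun j : Fin (n + 1) => (j : ℕ) < r)).map (Fin.succEmb (n + 1))
  have hT (j : Fin (n + 1)) : j.succ ∈ T ↔ j = Fin.last n ∨ (j : ℕ) < r := by simp [T]
  have hTcard : T.card = r + 1 := by
    rw [Finset.card_map, Finset.card_insert_of_notMem (by simpa using hr), Fin.card_filter_val_lt,
      min_eq_right (by omega)]
  obtain ⟨σ, hσ⟩ := exists_perm_mem_iff (hS.trans hTcard.symm)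
  set u : Fin (n + 2) → UnitAddCircle := fun i => if i ∈ T then unitFrac (p ^ 2) else unitFrac p
    with hu
  have hGσ : simplexGroup (v ∘ σ) = AddSubgroup.zmultiples u := by
    rw [simplexGroup_comp_perm v σ (hG.trans (AddSubgroup.zmultiples_eq_closure _)),
      Set.image_singleton, AddSubgroup.zmultiples_eq_closure u]
    simp only [Function.comp_def, hσ, hu]
  have hmem : u ∈ simplexGroup (v ∘ σ) := hGσ ▸ AddSubgroup.mem_zmultiples u
  refine unimodularlyEquivalent_rowSimplex hv (by simp [det_matrixA, hp.ne']) σ <|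
    hGσ.trans (simplexGroup_matrixA_snoc (pow_pos hp 2) _ (mem_simplexGroup.1 hmem).1 ?_ ?_).symm
  · rw [hu, ← Fin.succ_last]
    exact if_pos ((hT _).2 (.inl rfl))
  · intro j
    simp only [hu, hT, Fin.castSucc_ne_last, false_or, Fin.val_castSucc]
    split_ifs <;> simp

theorem unimodularlyEquivalent_simplexBC_of_ite {q : ℕ} (hq : 0 < q)
    (hv : AffineIndependent ℝ fun i => toReal (v i)) {S : Finset (Fin (n + 2))} {t : Fin n}
    (hS : S.card = t + 1)
    (hG : simplexGroup v = AddSubgroup.closure {fun i => if i ∈ S then unitFrac q else 0,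
      fun i => if i ∈ S then 0 else unitFrac q}) :
    UnimodularlyEquivalent (convexHull ℝ (Set.range fun i => toReal (v i)))
      (rowSimplex (blockMatrix q t)) := by
  let T : Finset (Fin (n + 2)) := (Finset.Iic t.castSucc).map (Fin.succEmb (n + 1))
  have hT (j : Fin (n + 1)) : j.succ ∈ T ↔ j ≤ t.castSucc := by simp [T]
  have hTcard : T.card = t + 1 := by rw [Finset.card_map, Fin.card_Iic, Fin.val_castSucc]
  obtain ⟨σ, hσ⟩ := exists_perm_mem_iff (hS.trans hTcard.symm)
  set x : Fin (n + 2) → UnitAddCircle := fun i => if i ∈ T then unitFrac q else 0 with hx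
  set y : Fin (n + 2) → UnitAddCircle := fun i => if i ∈ T then 0 else unitFrac q with hy
  have hGσ : simplexGroup (v ∘ σ) = AddSubgroup.closure {x, y} := by
    rw [simplexGroup_comp_perm v σ hG, Set.image_pair]
    simp only [Function.comp_def, hσ, hx, hy]
  have hx_mem : x ∈ simplexGroup (v ∘ σ) := hGσ ▸ AddSubgroup.subset_closure (by simp)
  have hy_mem : y ∈ simplexGroup (v ∘ σ) := hGσ ▸ AddSubgroup.subset_closure (by simp)
  have hdet : (blockMatrix q t).det ≠ 0 :=
    det_matrixBC_ne_zero (by simp [hq.ne']) (by simp [hq.ne'])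
  refine unimodularlyEquivalent_rowSimplex hv hdet σ <| hGσ.trans (simplexGroup_blockMatrix hq
    (mem_simplexGroup.1 hx_mem).1 (mem_simplexGroup.1 hy_mem).1 ?_ ?_).symm
  · exact fun j => by simp only [hx, hT]
  · exact fun j => by simp only [hy, hT]

end NormalForms

section Sequences

variable {n : ℕ} {v : Fin (n + 2) → Fin (n + 1) → ℤ} {p k : ℕ}

theorem exists_listA₁_of_const (hp : 1 < p) (hv : AffineIndependent ℝ fun i => toReal (v i))
    (hcard : n + 2 = p ^ 2 * (k + 1))
    (hG : simplexGroup v = AddSubgroup.zmultiples fun _ => unitFrac (p ^ 2)) :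
    ∃ A : Fin (n + 1) → ℤ, List.ofFn A = listA₁ p k ∧
      UnimodularlyEquivalent (convexHull ℝ (Set.range fun i => toReal (v i))) (simplexA A) := by
  refine ⟨_, ?_, unimodularlyEquivalent_simplexA_of_const (by positivity) hv hG⟩
  rw [ofFn_snoc_const, listA₁, Nat.cast_pow, ← hcard, Nat.add_sub_cancel]

theorem exists_listA₂_of_ite (hp : 1 < p) (hv : AffineIndependent ℝ fun i => toReal (v i))
    {S : Finset (Fin (n + 2))} (hS : S.card = p * (k + 1))
    (hcard : n + 2 = p * (k + 1) + (p ^ 2 - 1) * (k + 1))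
    (hG : simplexGroup v =
      AddSubgroup.zmultiples fun i => if i ∈ S then unitFrac (p ^ 2) else unitFrac p) :
    ∃ A : Fin (n + 1) → ℤ, List.ofFn A = listA₂ p k ∧
      UnimodularlyEquivalent (convexHull ℝ (Set.range fun i => toReal (v i))) (simplexA A) := by
  have hr : 0 < p * (k + 1) := by positivity
  have hs : 0 < (p ^ 2 - 1) * (k + 1) :=
    Nat.mul_pos (Nat.sub_pos_of_lt (one_lt_pow₀ hp two_ne_zero)) k.succ_pos
  obtain rfl : n = (p * (k + 1) - 1) + ((p ^ 2 - 1) * (k + 1) - 1) := by omega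
  refine ⟨_, ?_, unimodularlyEquivalent_simplexA_of_ite (by positivity) (Nat.le_add_right _ _) hv
    (hS.trans (Nat.sub_add_cancel hr).symm) hG⟩
  rw [ofFn_snoc_ite, listA₂, Nat.cast_pow]

theorem exists_listB_listC_of_ite (hp : 1 < p) (hv : AffineIndependent ℝ fun i => toReal (v i))
    {S : Finset (Fin (n + 2))} (hS : S.card = p * (k + 1))
    (hcard : n + 2 = p * (k + 1) + p ^ 2 * (k + 1))
    (hG : simplexGroup v = AddSubgroup.closure {fun i => if i ∈ S then unitFrac p else 0,
      fun i => if i ∈ S then 0 else unitFrac p}) :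
    ∃ (s : ℕ) (B : Fin s → ℤ) (C : Fin (n + 1) → ℤ),
      List.ofFn B = listB p k ∧ List.ofFn C = listC p k ∧
      UnimodularlyEquivalent (convexHull ℝ (Set.range fun i => toReal (v i)))
        (simplexBC B C) := by
  have hr : 0 < p * (k + 1) := by positivity
  have hs : 2 ≤ p ^ 2 * (k + 1) := by nlinarith
  obtain rfl : n = p * (k + 1) + (p ^ 2 * (k + 1) - 2) := by omega
  let t : Fin (p * (k + 1) + (p ^ 2 * (k + 1) - 2)) := ⟨p * (k + 1) - 1, by omega⟩
  have ht (j : Fin (p * (k + 1) + (p ^ 2 * (k + 1) - 2))) : j ≤ t ↔ (j : ℕ) < p * (k + 1) :=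
    Nat.le_sub_one_iff_lt hr
  refine ⟨t + 1, _, _, ofFn_snoc_const _ _ _, ?_, unimodularlyEquivalent_simplexBC_of_ite
    (by positivity) hv (hS.trans (Nat.sub_add_cancel hr).symm) hG⟩
  simp only [ht, ofFn_snoc_ite, listC]

end Sequences

end LatticeSimplices

end

theorem corollary3p6 (p k d : ℕ) (hp : p.Prime) (Δ : Set (Fin d → ℝ))
    (hΔ : LatticeSimplices.IsLatticeSimplex Δ)
    (hδ : LatticeSimplices.deltaSeries Δ =
      ∑ i ∈ Finset.range (p ^ 2), (PowerSeries.X : PowerSeries ℤ) ^ (i * (k + 1)))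
    (hpyr : ¬ LatticeSimplices.IsLatticePyramid Δ) :
    (∃ A : Fin d → ℤ, List.ofFn A = LatticeSimplices.listA₁ p k ∧
      LatticeSimplices.UnimodularlyEquivalent Δ (LatticeSimplices.simplexA A)) ∨
    (∃ A : Fin d → ℤ, List.ofFn A = LatticeSimplices.listA₂ p k ∧
      LatticeSimplices.UnimodularlyEquivalent Δ (LatticeSimplices.simplexA A)) ∨
    (∃ (s : ℕ) (B : Fin s → ℤ) (C : Fin d → ℤ),
      List.ofFn B = LatticeSimplices.listB p k ∧ List.ofFn C = LatticeSimplices.listC p k ∧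
      LatticeSimplices.UnimodularlyEquivalent Δ (LatticeSimplices.simplexBC B C)) := by
  obtain ⟨v, hv, rfl⟩ := hΔ
  obtain ⟨h, hbij, hh⟩ := LatticeSimplices.exists_bijOn_height hv k.succ_pos hδ
  rcases d with _ | n
  · obtain ⟨θ, -, hθ⟩ := hbij.surjOn
      (show 1 ∈ Set.Iio (p ^ 2) from one_lt_pow₀ hp.one_lt two_ne_zero)
    have hlt : (k + 1 : ℝ) < 1 := by
      simpa [hh, hθ] using LatticeSimplices.height_lt_card θ.1
    exact absurd hlt (by simp)
  have hne (i : Fin (n + 2)) : ∃ θ ∈ LatticeSimplices.simplexGroup v, θ i ≠ 0 := by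
    contrapose! hpyr
    exact LatticeSimplices.isLatticePyramid_of_simplexGroup_apply_eq_zero hv hpyr
  rcases LatticeSimplices.eq_zmultiples_or_eq_closure_of_bijOn_height hp k.succ_pos hbij hh hne with
    ⟨hcard, hG⟩ | ⟨S, hS, hcard, hG⟩ | ⟨S, hS, hcard, hG⟩ <;> rw [Fintype.card_fin] at hcard
  · exact .inl (LatticeSimplices.exists_listA₁_of_const hp.one_lt hv hcard hG)
  · exact .inr (.inl (LatticeSimplices.exists_listA₂_of_ite hp.one_lt hv hS hcard hG))
  · exact .inr (.inr (LatticeSimplices.exists_listB_listC_of_ite hp.one_lt hv hS hcard hG))
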